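/- Let $\Gamma$ be a group with a finite generating set $S=S^{-1}$ and word metric $d_S(g,h)=\min\{n : g a_1\cdots a_n=h,\ a_i\in S\}$, and give $\mathbf H^2\times\mathbf R$ the Riemannian product metric $\sqrt{d_{\mathbf H^2}^2+d_{\mathbf R}^2}$. A $(\lambda,\epsilon,\delta)$-quasi-isometry ($\lambda\ge 1$, $\epsilon\ge 0$) is a map $f:X\to Y$ with $\frac1\lambda d(x_1,x_2)-\epsilon\le d(f(x_1),f(x_2))\le\lambda d(x_1,x_2)+\epsilon$ for all $x_1,x_2\in X$ and such that every point of $Y$ is within $\delta$ of $f(X)$; two spaces are quasi-isometric if there are $(\lambda,\epsilon,\delta)$-quasi-isometries (for some $\lambda,\epsilon,\delta$) in both directions whose two composites are each within bounded distance of the identity. Suppose $\Gamma$ is quasi-isometric to $\mathbf H^2\times\mathbf R$ through such $(\lambda,\epsilon,\delta)$-quasi-isometries $\psi:\Gamma\to\mathbf H^2\times\mathbf R$ and $\omega:\mathbf H^2\times\mathbf R\to\Gamma$. For $u\in\Gamma$ let $\phi_u(x)=\psi(u\,\omega(x))$, and let $f_u:\mathbf H^2\to\mathbf H^2$ send $z$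 to the $\mathbf H^2$-coordinate of $\phi_u(z,0)$. Say that a map $F:\partial\mathbf H^2\to\partial\mathbf H^2$ gives the boundary values of $f:\mathbf H^2\to\mathbf H^2$ if, for every geodesic ray $\gamma$ with endpoint $\xi$, the image $f(\gamma)$ is within bounded distance of a geodesic ray with endpoint $F(\xi)$. Then there is exactly one action $\Xi$ of $\Gamma$ on the set $\partial\mathbf H^2$ such that $\Xi(u)$ gives the boundary values of $f_u$ for every $u\in\Gamma$ (the boundary action), and: 1. $\ker\Xi$ is either finite, or finitely generated and, with the word metric of any finite symmetric generating set, quasi-isometric to $\mathbf R$. 2. If $\ker\Xi$ is infinite, it contains an element of infinite order; and every element of infinite order in $\ker\Xi$ generates a subgroup of finite index in $\ker\Xi$. 3. If $\Phi:\Gamma\to\mathrm{Isom}(\mathbf H^2)$ is a homomorphism conjugate to the boundary action, that is, if there is a bijection $h:\partial\mathbf H^2\to\partial\mathbf H^2$ (for instance a quasisymmetric homeomorphism) such that $h\,\Xi(u)\,h^{-1}$ gives the boundary values of $\Phi(u)$ for every $u\in\Gamma$, then $\ker\Phi=\ker\Xi$. In particular $\ker\Phi$ is either finite or quasi-isometric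 to $\mathbf R$ (in the sense of 1). -/

import Mathlib

open scoped NNReal UpperHalfPlane

noncomputable section

/-! ### Word metrics and quasi-isometries -/

/-- A finite set generating the group `Γ` and containing the inverses of its elements. -/
def IsSymmGeneratingSet {Γ : Type*} [Group Γ] (S : Finset Γ) : Prop :=
  (∀ a ∈ S, a⁻¹ ∈ S) ∧ Subgroup.closure (S : Set Γ) = ⊤

/-- The word metric: the least `n` with `g * a₁ * ⋯ * aₙ = h` for some `aᵢ ∈ S`. -/
def wordDist {Γ : Type*} [Group Γ] (S : Finset Γ) (g h : Γ) : ℝ :=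
  ((sInf {n : ℕ | ∃ l : List Γ, l.length = n ∧ (∀ a ∈ l, a ∈ S) ∧ g * l.prod = h} : ℕ) : ℝ)

/-- `f` is a `(lam, ε, δ)`-quasi-isometry from `(X, dX)` to `(Y, dY)`
(coarsely bi-Lipschitz and almost surjective). -/
structure IsQuasiIsometry {X Y : Type*} (dX : X → X → ℝ) (dY : Y → Y → ℝ)
    (lam ε δ : ℝ) (f : X → Y) : Prop where
  one_le : 1 ≤ lam
  eps_nonneg : 0 ≤ ε
  lower : ∀ x₁ x₂, 1 / lam * dX x₁ x₂ - ε ≤ dY (f x₁) (f x₂)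
  upper : ∀ x₁ x₂, dY (f x₁) (f x₂) ≤ lam * dX x₁ x₂ + ε
  almost_surj : ∀ y, ∃ x, dY y (f x) ≤ δ

/-- `ψ : X → Y` and `ω : Y → X` are `(lam, ε, δ)`-quasi-isometries that are almost inverses
of each other. -/
structure IsQuasiIsometryPair {X Y : Type*} (dX : X → X → ℝ) (dY : Y → Y → ℝ)
    (lam ε δ : ℝ) (ψ : X → Y) (ω : Y → X) : Prop where
  left : IsQuasiIsometry dX dY lam ε δ ψ
  right : IsQuasiIsometry dY dX lam ε δ ω
  almost_inverse : ∃ κ : ℝ, (∀ x, dX x (ω (ψ x)) ≤ κ) ∧ ∀ y, dY y (ψ (ω y)) ≤ κ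

/-- `(X, dX)` and `(Y, dY)` are quasi-isometric. -/
def QuasiIsometric {X Y : Type*} (dX : X → X → ℝ) (dY : Y → Y → ℝ) : Prop :=
  ∃ (lam ε δ : ℝ) (ψ : X → Y) (ω : Y → X), IsQuasiIsometryPair dX dY lam ε δ ψ ω

/-- A group is quasi-isometric to `ℝ`: it is finitely generated and, with the word metric of any
finite symmetric generating set, it is quasi-isometric to the real line. -/
def GroupQuasiIsometricToReal (K : Type*) [Group K] : Prop :=
  Group.FG K ∧ ∀ T : Finset K, IsSymmGeneratingSet T →
    QuasiIsometric (wordDist T) (fun s t : ℝ => dist s t)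

/-! ### The space `ℍ² × ℝ` and the quasi-action -/

/-- The Riemannian product of the hyperbolic plane (upper half-plane, curvature `-1`) and the
real line: the distance is `√(d_ℍ² + d_ℝ²)`. -/
abbrev HypPlaneTimesReal : Type := WithLp 2 (ℍ × ℝ)

/-- The quasi-action `φ_u = ψ ∘ (left multiplication by u) ∘ ω`. -/
def quasiAction {Γ : Type*} [Group Γ] (ψ : Γ → HypPlaneTimesReal) (ω : HypPlaneTimesReal → Γ)
    (u : Γ) (x : HypPlaneTimesReal) : HypPlaneTimesReal :=
  ψ (u * ω x)

/-- The map `π ∘ φ_u` restricted to the horizontal plane `ℍ × {0}`, as a self-map of `ℍ`. -/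
def horizontalMap {Γ : Type*} [Group Γ] (ψ : Γ → HypPlaneTimesReal) (ω : HypPlaneTimesReal → Γ)
    (u : Γ) (z : ℍ) : ℍ :=
  (quasiAction ψ ω u (WithLp.toLp 2 (z, 0))).fst

/-! ### The boundary circle and boundary values

The boundary of the upper half-plane is the circle `OnePoint ℝ = ℝ ∪ {∞}`, sitting with `ℍ`
in the Riemann sphere `OnePoint ℂ`. -/

/-- The unit speed geodesic ray `γ : [0, ∞) → ℍ` has endpoint `ξ`. -/
def IsGeodesicRayTo (γ : ℝ≥0 → ℍ) (ξ : OnePoint ℝ) : Prop :=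
  Isometry γ ∧
    Filter.Tendsto (fun t => (((γ t : ℍ) : ℂ) : OnePoint ℂ)) Filter.atTop
      (nhds (OnePoint.map (fun x : ℝ => (x : ℂ)) ξ))

/-- `F` gives the boundary values of `f : ℍ → ℍ`: for every geodesic ray `γ` with endpoint `ξ`,
the image `f(γ)` is within bounded distance of a geodesic ray with endpoint `F ξ`. -/
def IsBoundaryMap (f : ℍ → ℍ) (F : OnePoint ℝ → OnePoint ℝ) : Prop :=
  ∀ (ξ : OnePoint ℝ) (γ : ℝ≥0 → ℍ), IsGeodesicRayTo γ ξ →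
    ∃ γ' : ℝ≥0 → ℍ, IsGeodesicRayTo γ' (F ξ) ∧
      ∃ C : ℝ, ∀ t, ∃ s, dist (f (γ t)) (γ' s) ≤ C

/-- `Ξ` is the action of `Γ` on the boundary circle by the boundary values of the maps
`π ∘ φ_u`. -/
def IsBoundaryAction {Γ : Type*} [Group Γ] (ψ : Γ → HypPlaneTimesReal)
    (ω : HypPlaneTimesReal → Γ) (Ξ : Γ →* Equiv.Perm (OnePoint ℝ)) : Prop :=
  ∀ u, IsBoundaryMap (horizontalMap ψ ω u) (Ξ u)

/-- `Φ : Γ → Isom(ℍ)` is conjugate to the boundary action `Ξ`: for some bijection `h` of the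
boundary circle, the boundary values of each isometry `Φ u` are `h ∘ Ξ u ∘ h⁻¹`. -/
def IsConjugateToBoundaryAction {Γ : Type*} [Group Γ] (Ξ : Γ →* Equiv.Perm (OnePoint ℝ))
    (Φ : Γ →* (ℍ ≃ᵢ ℍ)) : Prop :=
  ∃ h : Equiv.Perm (OnePoint ℝ), ∀ u, IsBoundaryMap (Φ u) (h * Ξ u * h⁻¹ : Equiv.Perm _)

end

noncomputable section

open scoped MatrixGroups

/-! The maps `φ_u` form a quasi-action on `ℍ × ℝ` by uniform quasi-isometries. The crux is that such
maps coarsely permute the vertical lines (`exists_dist_fst_le`). Granted this, forgetting heights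
gives a quasi-action on `ℍ`. Stability of quasi-geodesics then supplies boundary values, which are
unique and hence compose, so the boundary action exists and is unique.

For the crux, conjugate vertical translations by a quasi-isometry `f`. The maps `f T_t f'` are
quasi-isometries with constants independent of `t`, and the horizontal displacement grows boundedly
when `t` moves by one. By `horizontal_displacement_improve`, a displacement bound `B` self-improves
to `B / 32 + C`, so induction on the size of `t` gives one bound for all `t`. The improvement comes
from a degree and area argument in a flat (geodesic times `ℝ`). A map `g` with horizontal
displacement at most `B`, followed by projection to the flat, carries a large box over a square of
side comparable to `B`, by a Sperner count. If every relevant image point were far from the flat,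
the exponential contraction of the projection would make the covering area too small. So some flat
point lands near the origin. Applied to the coarse inverse, this puts `g x` near every flat through
`x`, and two perpendicular flats pin down its `ℍ`-coordinate.

If `u` lies in the kernel, `f_u` has trivial boundary values and therefore moves points a uniformly
bounded amount: `f_u z` is near each of two perpendicular geodesics through `z`. The kernel thus
quasi-acts on one vertical line, properly because word balls are finite. Such a group has a coarse
orientation subgroup. If the group is infinite, an orientation preserving element of large
displacement has powers marching coarsely densely along the line, so it generates a subgroup of
finite index; this yields the first two assertions.

For the third, an isometry with trivial boundary values keeps each geodesic at bounded distance from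
itself, hence fixes every point. So `Φ u = 1` exactly when its boundary values are trivial, and
conjugation by `h` does not affect triviality. -/

/-! ### A Sperner-type covering lemma and coarsely monotone functions -/

/-- The edge indicator used in the parity count: the edge joins a vertex labelled `0` to a vertex
labelled `1`. -/
def edgeParity (a b : Fin 3) : ZMod 2 :=
  if (a = 0 ∧ b = 1) ∨ (a = 1 ∧ b = 0) then 1 else 0

/-- If the missing label is `0` or `1`, no side counts. If it is `2`, a closed walk on the labels
`0`, `1` switches an even number of times. -/
lemma edgeParity_square (a b c d k : Fin 3) (ha : a ≠ k) (hb : b ≠ k) (hc : c ≠ k) (hd : d ≠ k) :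
    edgeParity a b + edgeParity c d = edgeParity a c + edgeParity b d := by
  revert a b c d k
  decide

/-- A vertical edge shared by two neighbouring squares cancels mod 2, so only the two outermost
vertical edges survive. -/
lemma sum_edgeParity_succ (l : ℕ → ℕ → Fin 3) (j m : ℕ)
    (h : ∀ i < m, ∃ k, l i j ≠ k ∧ l (i + 1) j ≠ k ∧ l i (j + 1) ≠ k ∧ l (i + 1) (j + 1) ≠ k) :
    ∑ i ∈ Finset.range m, edgeParity (l i j) (l (i + 1) j)
      + ∑ i ∈ Finset.range m, edgeParity (l i (j + 1)) (l (i + 1) (j + 1))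
      = edgeParity (l 0 j) (l 0 (j + 1)) + edgeParity (l m j) (l m (j + 1)) := by
  induction m with
  | zero => simp [CharTwo.add_self_eq_zero]
  | succ m ih =>
    obtain ⟨k, h1, h2, h3, h4⟩ := h m (Nat.lt_succ_self m)
    have e := edgeParity_square _ _ _ _ k h1 h2 h3 h4
    have ih' := ih fun i hi => h i (Nat.lt_succ_of_lt hi)
    rw [Finset.sum_range_succ, Finset.sum_range_succ, add_add_add_comm, ih', e, add_assoc,
      ← add_assoc (edgeParity (l m j) (l m (j + 1))), CharTwo.add_self_eq_zero, zero_add]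

/-- A labelling of the `m × n` grid by three labels, with the boundary conditions of Sperner's
lemma, has a unit square carrying all three labels. -/
lemma exists_square_all_labels (l : ℕ → ℕ → Fin 3) (m n : ℕ)
    (hleft : ∀ j ≤ n, l 0 j = 0) (hright : ∀ j ≤ n, l m j ≠ 0)
    (hbot : ∀ i ≤ m, l i 0 ≠ 2) (htop : ∀ i ≤ m, l i n ≠ 1) :
    ∃ i < m, ∃ j < n, ∀ k, l i j = k ∨ l (i + 1) j = k ∨ l i (j + 1) = k
      ∨ l (i + 1) (j + 1) = k := by
  by_contra! hno
  have hb : ∀ r ≤ m, ∑ i ∈ Finset.range r, edgeParity (l i 0) (l (i + 1) 0)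
      = if l r 0 = 1 then 1 else 0 := by
    intro r hr
    induction r with
    | zero => simp [hleft 0 (Nat.zero_le _)]
    | succ r ih =>
      rw [Finset.sum_range_succ, ih (Nat.le_of_succ_le hr)]
      have h1 := hbot r (Nat.le_of_succ_le hr)
      have h2 := hbot (r + 1) hr
      generalize l r 0 = a at *
      generalize l (r + 1) 0 = b at *
      clear hno hleft hright hbot htop ih hr
      revert a b
      decide
  -- The parity is odd on the bottom row and is carried upwards unchanged: the left edges join `0`
  -- to `0` and the right edges avoid `0`. It contradicts the top row, which has no label `1`.
  have hrow : ∀ j ≤ n, ∑ i ∈ Finset.range m, edgeParity (l i j) (l (i + 1) j) = 1 := by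
    intro j hj
    induction j with
    | zero =>
      rw [hb m le_rfl, if_pos]
      have h1 := hright 0 (Nat.zero_le _)
      have h2 := hbot m le_rfl
      generalize l m 0 = a at *
      clear hno hleft hright hbot htop hb
      revert a
      decide
    | succ j ih =>
      have e := sum_edgeParity_succ l j m fun i hi => hno i hi j hj
      rw [ih (Nat.le_of_succ_le hj), hleft j (Nat.le_of_succ_le hj), hleft (j + 1) hj] at e
      have h1 := hright j (Nat.le_of_succ_le hj)
      have h2 := hright (j + 1) hj
      have e1 : edgeParity 0 0 = 0 := by decide
      have e2 : ∀ a b : Fin 3, a ≠ 0 → b ≠ 0 → edgeParity a b = 0 := by decide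
      rw [e1, e2 _ _ h1 h2, add_zero] at e
      generalize (∑ i ∈ Finset.range m, edgeParity (l i (j + 1)) (l (i + 1) (j + 1))) = x at *
      clear hno hleft hright hbot htop hb ih
      revert x
      decide
  have hz : ∑ i ∈ Finset.range m, edgeParity (l i n) (l (i + 1) n) = 0 := by
    refine Finset.sum_eq_zero fun i hi => ?_
    have h1 := htop i (Finset.mem_range.1 hi).le
    have h2 := htop (i + 1) (Finset.mem_range.1 hi)
    generalize l i n = a at *
    generalize l (i + 1) n = b at *
    clear hno hleft hright hbot htop hb hrow hi
    revert a b
    decide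
  rw [hrow n le_rfl] at hz
  exact one_ne_zero hz

/-- If a map from a grid to the plane sends the four sides of the grid to the corresponding
sides of the point `(y₁, y₂)`, then the corners of some unit square straddle `(y₁, y₂)`. -/
lemma exists_straddling_square (p q : ℕ → ℕ → ℝ) (m n : ℕ) (y₁ y₂ : ℝ)
    (hleft : ∀ j ≤ n, p 0 j < y₁) (hright : ∀ j ≤ n, y₁ ≤ p m j)
    (hbot : ∀ i ≤ m, q i 0 < y₂) (htop : ∀ i ≤ m, y₂ ≤ q i n) :
    ∃ i < m, ∃ j < n, ∃ a ∈ ({0, 1} : Finset ℕ), ∃ b ∈ ({0, 1} : Finset ℕ),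
      ∃ a' ∈ ({0, 1} : Finset ℕ), ∃ b' ∈ ({0, 1} : Finset ℕ),
      ∃ c ∈ ({0, 1} : Finset ℕ), ∃ d ∈ ({0, 1} : Finset ℕ),
      p (i + a) (j + b) < y₁ ∧ y₁ ≤ p (i + a') (j + b') ∧ q (i + a') (j + b') < y₂ ∧
        y₂ ≤ q (i + c) (j + d) := by
  classical
  -- A square with all three labels has values of `p` on both sides of `y₁` (labels 0, 1) and values
  -- of `q` on both sides of `y₂` (labels 1, 2).
  let l : ℕ → ℕ → Fin 3 := fun i j => if p i j < y₁ then 0 else if q i j < y₂ then 1 else 2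
  have h0 : ∀ i j, l i j = 0 → p i j < y₁ := by
    intro i j h
    by_contra hh
    simp only [l, if_neg hh] at h
    split_ifs at h
    · exact absurd h (by decide)
    · exact absurd h (by decide)
  have h1 : ∀ i j, l i j = 1 → y₁ ≤ p i j ∧ q i j < y₂ := by
    intro i j h
    simp only [l] at h
    split_ifs at h with h1 h2
    · exact absurd h (by decide)
    · exact ⟨not_lt.1 h1, h2⟩
    · exact absurd h (by decide)
  have h2 : ∀ i j, l i j = 2 → y₂ ≤ q i j := by
    intro i j h
    simp only [l] at h
    split_ifs at h with h1 h2
    · exact absurd h (by decide)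
    · exact absurd h (by decide)
    · exact not_lt.1 h2
  obtain ⟨i, hi, j, hj, hk⟩ := exists_square_all_labels l m n
    (fun j hj => by simp [l, hleft j hj])
    (fun j hj h => absurd (h0 _ _ h) (not_lt.2 (hright j hj)))
    (fun i hi h => absurd (hbot i hi) (not_lt.2 (h2 _ _ h)))
    (fun i hi h => absurd (h1 _ _ h).2 (not_lt.2 (htop i hi)))
  have key : ∀ k, ∃ a ∈ ({0, 1} : Finset ℕ), ∃ b ∈ ({0, 1} : Finset ℕ),
      l (i + a) (j + b) = k := by
    intro k
    rcases hk k with h | h | h | h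
    · exact ⟨0, by simp, 0, by simp, h⟩
    · exact ⟨1, by simp, 0, by simp, h⟩
    · exact ⟨0, by simp, 1, by simp, h⟩
    · exact ⟨1, by simp, 1, by simp, h⟩
  obtain ⟨a, ha, b, hb, hab⟩ := key 0
  obtain ⟨a', ha', b', hb', hab'⟩ := key 1
  obtain ⟨c, hc, d, hd, hcd⟩ := key 2
  exact ⟨i, hi, j, hj, a, ha, b, hb, a', ha', b', hb', c, hc, d, hd, h0 _ _ hab,
    (h1 _ _ hab').1, (h1 _ _ hab').2, h2 _ _ hcd⟩

/-- A square of side `2 r` covered by finitely many rectangles of half-sides `w` and `k`. -/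
lemma sq_le_of_covered_by_rectangles {ι : Type*} (s : Finset ι) (P Q : ι → ℝ) (r w k : ℝ)
    (hr : 0 ≤ r) (hw : 0 ≤ w) (hk : 0 ≤ k)
    (hcov : ∀ y₁ y₂ : ℝ, |y₁| ≤ r → |y₂| ≤ r → ∃ v ∈ s, |y₁ - P v| ≤ w ∧ |y₂ - Q v| ≤ k) :
    (2 * r) ^ 2 ≤ s.card * ((2 * w) * (2 * k)) := by
  classical
  have hsub : (Set.Icc (-r) r ×ˢ Set.Icc (-r) r : Set (ℝ × ℝ)) ⊆
      ⋃ v ∈ s, Set.Icc (P v - w) (P v + w) ×ˢ Set.Icc (Q v - k) (Q v + k) := by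
    rintro ⟨y₁, y₂⟩ ⟨h1, h2⟩
    obtain ⟨v, hv, h3, h4⟩ := hcov y₁ y₂ (abs_le.2 h1) (abs_le.2 h2)
    rw [abs_le] at h3 h4
    simp only [Set.mem_iUnion]
    refine ⟨v, hv, ⟨?_, ?_⟩, ?_, ?_⟩ <;> dsimp only <;> linarith
  have h := (MeasureTheory.measure_mono (μ := MeasureTheory.volume) hsub).trans
    (MeasureTheory.measure_biUnion_finset_le s _)
  simp only [MeasureTheory.Measure.volume_eq_prod, MeasureTheory.Measure.prod_prod,
    Real.volume_Icc] at h
  have e1 : r - -r = 2 * r := by ring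
  have e2 : ∀ v, P v + w - (P v - w) = 2 * w := fun v => by ring
  have e3 : ∀ v, Q v + k - (Q v - k) = 2 * k := fun v => by ring
  simp only [e1, e2, e3, Finset.sum_const, nsmul_eq_mul] at h
  rw [← ENNReal.ofReal_mul (by positivity), ← ENNReal.ofReal_mul (by positivity),
    ← ENNReal.ofReal_natCast, ← ENNReal.ofReal_mul (by positivity),
    ENNReal.ofReal_le_ofReal_iff (by positivity)] at h
  nlinarith [h]

/-- A function on the line which moves little over unit steps and much over steps of length at
least `T` is coarsely increasing or coarsely decreasing. -/
lemma coarsely_increasing_or_decreasing (q : ℝ → ℝ) (K T : ℝ)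
    (hK : ∀ s t, |s - t| ≤ 1 → |q s - q t| ≤ K)
    (hT : ∀ s t, T ≤ |s - t| → 2 * K < |q s - q t|) (hT0 : 0 ≤ T) :
    (∀ s t, s + T ≤ t → q s < q t) ∨ ∀ s t, s + T ≤ t → q t < q s := by
  -- On this convex, hence connected, set of pairs the sign of `q t - q s` is locally constant:
  -- moving both entries by at most one changes the difference by at most `2 K`, less than its size.
  let U : Set (ℝ × ℝ) := {x | x.1 + T ≤ x.2}
  have hU : Convex ℝ U := by
    intro x hx y hy a b ha hb hab
    simp only [U, Set.mem_ofPred_eq, Prod.fst_add, Prod.smul_fst, Prod.snd_add, Prod.smul_snd,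
      smul_eq_mul] at *
    have : T = a * T + b * T := by rw [← add_mul, hab, one_mul]
    rw [this]
    nlinarith
  have hbig : ∀ x ∈ U, 2 * K < |q x.2 - q x.1| := by
    intro x hx
    refine hT _ _ ?_
    have : x.1 + T ≤ x.2 := hx
    rw [abs_of_nonneg] <;> linarith
  have hind : ∀ x ∈ U, ∀ y ∈ U, (q x.1 < q x.2 ↔ q y.1 < q y.2) := by
    intro x hx y hy
    refine hU.isPreconnected.induction₂
      (fun x y => (q x.1 < q x.2 ↔ q y.1 < q y.2)) ?_ ?_ ?_ hx hy
    · intro x hx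
      have hev : ∀ᶠ y in nhdsWithin x U, y ∈ Metric.ball x 1 ∧ y ∈ U :=
        Filter.Eventually.and (mem_nhdsWithin_of_mem_nhds (Metric.ball_mem_nhds x one_pos))
          self_mem_nhdsWithin
      filter_upwards [hev] with y hy
      obtain ⟨hy, hyU⟩ := hy
      have hd : dist y x < 1 := hy
      rw [Prod.dist_eq, max_lt_iff, Real.dist_eq, Real.dist_eq] at hd
      have h1 := abs_le.1 (hK _ _ hd.1.le)
      have h2 := abs_le.1 (hK _ _ hd.2.le)
      have h3 := hbig x hx
      have h4 := hbig y hyU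
      constructor
      · intro h
        rw [abs_of_pos (by linarith)] at h3
        linarith
      · intro h
        rw [abs_of_pos (by linarith)] at h4
        linarith
    · intro x y z _ _ _ h1 h2
      exact h1.trans h2
    · intro x y _ _ h
      exact h.symm
  have h0 : ((0 : ℝ), T) ∈ U := by simp [U]
  by_cases h : q 0 < q T
  · left
    intro s t hst
    exact (hind (0, T) h0 (s, t) hst).1 h
  · right
    intro s t hst
    have h1 : ¬ q s < q t := fun h' => h ((hind (0, T) h0 (s, t) hst).2 h')
    have h2 := hbig (s, t) hst
    have hK0 : 0 ≤ K := (abs_nonneg _).trans (hK 0 0 (by simp))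
    refine lt_of_le_of_ne (not_lt.1 h1) fun h3 => ?_
    simp only [h3, sub_self, abs_zero] at h2
    linarith

/-! ### The imaginary axis of the upper half-plane and the projection onto it -/


/-- The unit speed parametrisation of the imaginary axis. -/
def axisPt (a : ℝ) : ℍ := ⟨⟨0, Real.exp a⟩, Real.exp_pos a⟩

/-- The hyperbolic cosine of the distance to the imaginary axis. -/
def axisRatio (z : ℍ) : ℝ := ‖(z : ℂ)‖ / z.im

/-- The parameter of the nearest point projection to the imaginary axis. -/
def axisProj (z : ℍ) : ℝ := Real.log ‖(z : ℂ)‖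

lemma UpperHalfPlane.norm_pos (z : ℍ) : 0 < ‖(z : ℂ)‖ := norm_pos_iff.2 z.ne_zero

lemma UpperHalfPlane.norm_sq_eq (z : ℍ) : ‖(z : ℂ)‖ ^ 2 = z.re ^ 2 + z.im ^ 2 := by
  rw [Complex.sq_norm, Complex.normSq_apply, UpperHalfPlane.coe_re, UpperHalfPlane.coe_im]
  ring

@[simp] lemma axisPt_re (a : ℝ) : (axisPt a).re = 0 := rfl

@[simp] lemma axisPt_im (a : ℝ) : (axisPt a).im = Real.exp a := rfl

@[simp] lemma axisPt_zero : axisPt 0 = UpperHalfPlane.I :=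
  UpperHalfPlane.ext_re_im (by simp) (by simp)

lemma norm_axisPt (a : ℝ) : ‖((axisPt a : ℍ) : ℂ)‖ = Real.exp a := by
  have h := UpperHalfPlane.norm_sq_eq (axisPt a)
  rw [axisPt_re, axisPt_im] at h
  have := Real.exp_pos a
  exact (sq_eq_sq₀ (norm_nonneg _) this.le).1 (by rw [h]; ring)

lemma isometry_axisPt : Isometry axisPt := UpperHalfPlane.isometry_vertical_line 0

lemma dist_axisPt (a b : ℝ) : dist (axisPt a) (axisPt b) = |a - b| := by
  rw [isometry_axisPt.dist_eq, Real.dist_eq]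

@[simp] lemma axisProj_axisPt (a : ℝ) : axisProj (axisPt a) = a := by
  rw [axisProj, norm_axisPt, Real.log_exp]

lemma one_le_axisRatio (z : ℍ) : 1 ≤ axisRatio z := by
  rw [axisRatio, le_div_iff₀ z.im_pos, one_mul]
  exact (le_abs_self _).trans (Complex.abs_im_le_norm _)

lemma axisRatio_pos (z : ℍ) : 0 < axisRatio z := one_pos.trans_le (one_le_axisRatio z)

lemma cosh_dist_eq (z w : ℍ) : Real.cosh (dist z w)
    = (‖(z : ℂ)‖ ^ 2 + ‖(w : ℂ)‖ ^ 2 - 2 * z.re * w.re) / (2 * z.im * w.im) := by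
  have hz := z.im_pos
  have hw := w.im_pos
  rw [UpperHalfPlane.cosh_dist', UpperHalfPlane.norm_sq_eq, UpperHalfPlane.norm_sq_eq]
  congr 1
  ring

lemma cosh_dist_axisPt (z : ℍ) (a : ℝ) : Real.cosh (dist z (axisPt a))
    = (‖(z : ℂ)‖ ^ 2 + Real.exp a ^ 2) / (2 * z.im * Real.exp a) := by
  rw [cosh_dist_eq, norm_axisPt, axisPt_re, axisPt_im]
  simp

lemma exp_axisProj (z : ℍ) : Real.exp (axisProj z) = ‖(z : ℂ)‖ := Real.exp_log z.norm_pos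

lemma cosh_dist_axisPt_axisProj (z : ℍ) :
    Real.cosh (dist z (axisPt (axisProj z))) = axisRatio z := by
  rw [cosh_dist_axisPt, exp_axisProj, axisRatio]
  have h1 := z.norm_pos
  have h2 := z.im_pos
  field_simp
  ring

lemma exp_le_two_mul_cosh (x : ℝ) : Real.exp x ≤ 2 * Real.cosh x := by
  rw [Real.cosh_eq]
  have := Real.exp_pos (-x)
  linarith

lemma cosh_le_exp_of_nonneg {x : ℝ} (hx : 0 ≤ x) : Real.cosh x ≤ Real.exp x := by
  rw [Real.cosh_eq]
  have : Real.exp (-x) ≤ Real.exp x := Real.exp_le_exp.2 (by linarith)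
  linarith

lemma le_log_of_cosh_le {x c : ℝ} (h : Real.cosh x ≤ c) : x ≤ Real.log (2 * c) := by
  have h1 := exp_le_two_mul_cosh x
  have h2 := Real.exp_pos x
  rw [Real.le_log_iff_exp_le (by linarith)]
  linarith

lemma dist_axisPt_axisProj_le (z : ℍ) :
    dist z (axisPt (axisProj z)) ≤ Real.log (2 * axisRatio z) :=
  le_log_of_cosh_le (cosh_dist_axisPt_axisProj z).le

lemma axisRatio_le_cosh (z : ℍ) (a : ℝ) : axisRatio z ≤ Real.cosh (dist z (axisPt a)) := by
  have h1 := z.norm_pos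
  have h2 := z.im_pos
  have h3 := Real.exp_pos a
  rw [cosh_dist_axisPt, axisRatio, div_le_div_iff₀ h2 (by positivity)]
  nlinarith [mul_nonneg h2.le (sq_nonneg (‖(z : ℂ)‖ - Real.exp a))]

lemma axisRatio_le_exp (z : ℍ) (a : ℝ) : axisRatio z ≤ Real.exp (dist z (axisPt a)) :=
  (axisRatio_le_cosh z a).trans (cosh_le_exp_of_nonneg dist_nonneg)

lemma axisRatio_le_mul_axisRatio (z w : ℍ) :
    axisRatio w ≤ 2 * Real.exp (dist w z) * axisRatio z := by
  have h1 := axisRatio_le_exp w (axisProj z)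
  have h2 : dist w (axisPt (axisProj z)) ≤ dist w z + Real.log (2 * axisRatio z) :=
    (dist_triangle _ z _).trans (by linarith [dist_axisPt_axisProj_le z])
  have h3 := Real.exp_le_exp.2 h2
  rw [Real.exp_add, Real.exp_log (by linarith [axisRatio_pos z])] at h3
  linarith

/-- Projection to a geodesic does not increase distance. After taking `cosh`, this comes down to
Cauchy–Schwarz for the vectors `(re, im)`. -/
lemma abs_axisProj_sub_le (z w : ℍ) : |axisProj z - axisProj w| ≤ dist z w := by
  have hz := z.norm_pos
  have hw := w.norm_pos
  have h1 := z.im_pos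
  have h2 := w.im_pos
  have e1 := z.norm_sq_eq
  have e2 := w.norm_sq_eq
  have : |axisProj z - axisProj w| ≤ |dist z w| := by
    rw [← Real.cosh_le_cosh, cosh_dist_eq,
      Real.cosh_eq, Real.exp_sub, Real.exp_neg, Real.exp_sub, exp_axisProj, exp_axisProj, inv_div]
    set r := ‖(z : ℂ)‖
    set s := ‖(w : ℂ)‖
    have key : z.re * w.re + z.im * w.im ≤ r * s := by
      refine abs_le_of_sq_le_sq' ?_ (by positivity) |>.2
      rw [mul_pow, e1, e2]
      nlinarith [sq_nonneg (z.re * w.im - z.im * w.re)]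
    have key2 : (r ^ 2 + s ^ 2) * (z.im * w.im) ≤ (r ^ 2 + s ^ 2 - 2 * z.re * w.re) * (r * s) := by
      have : z.im * w.im ≤ r * s := by
        refine abs_le_of_sq_le_sq' ?_ (by positivity) |>.2
        rw [mul_pow, mul_pow, e1, e2]
        nlinarith [mul_nonneg (sq_nonneg z.re) (sq_nonneg w.re),
          mul_nonneg (sq_nonneg z.re) (sq_nonneg w.im), mul_nonneg (sq_nonneg z.im) (sq_nonneg w.re)]
      nlinarith [mul_nonneg (sub_nonneg.2 this) (sq_nonneg (r - s)),
        mul_nonneg (mul_nonneg hz.le hw.le) (sub_nonneg.2 key)]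
    have e : (r / s + s / r) / 2 = (r ^ 2 + s ^ 2) / (2 * (r * s)) := by
      field_simp
    rw [e, div_le_div_iff₀ (by positivity) (by positivity)]
    nlinarith [key2]
  rwa [abs_of_nonneg dist_nonneg] at this

/-- The projection to the axis contracts exponentially in the distance to the axis. -/
lemma abs_axisProj_sub_le_div {z w : ℍ} {K : ℝ} (h : dist z w ≤ K) :
    |axisProj w - axisProj z| ≤ Real.exp K * (1 + Real.exp K) / axisRatio z := by
  have hz := z.norm_pos
  have hw := w.norm_pos
  have h1 := z.im_pos
  have hE := Real.exp_pos K
  -- A hyperbolic ball of radius `K` about `z` has Euclidean size comparable to `z.im`, so `log ‖·‖`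
  -- varies on it by a multiple of `z.im / ‖z‖ = 1 / axisRatio z`.
  have d1 : dist (z : ℂ) w ≤ Real.exp K * z.im := by
    have e := UpperHalfPlane.dist_coe_le w z
    rw [dist_comm] at e
    have : Real.exp (dist w z) ≤ Real.exp K := Real.exp_le_exp.2 (by rwa [dist_comm])
    nlinarith
  have d2 : dist (z : ℂ) w ≤ Real.exp K * w.im := by
    have e := UpperHalfPlane.dist_coe_le z w
    have : Real.exp (dist z w) ≤ Real.exp K := Real.exp_le_exp.2 h
    nlinarith [w.im_pos]
  have n1 : |‖(z : ℂ)‖ - ‖(w : ℂ)‖| ≤ dist (z : ℂ) w := by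
    rw [dist_eq_norm]
    exact abs_norm_sub_norm_le _ _
  have hwim : w.im ≤ ‖(w : ℂ)‖ := (le_abs_self _).trans (Complex.abs_im_le_norm _)
  have n2 : ‖(z : ℂ)‖ ≤ (1 + Real.exp K) * ‖(w : ℂ)‖ := by
    have := (abs_le.1 n1).2
    nlinarith
  have lg : ∀ a b : ℝ, 0 < a → 0 < b → Real.log a - Real.log b ≤ (a - b) / b := by
    intro a b ha hb
    rw [← Real.log_div ha.ne' hb.ne', sub_div, div_self hb.ne']
    exact Real.log_le_sub_one_of_pos (div_pos ha hb)
  have n1' := abs_le.1 (n1.trans d1)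
  rw [abs_le]
  simp only [axisProj, axisRatio]
  have e : Real.exp K * (1 + Real.exp K) / (‖(z : ℂ)‖ / z.im)
      = Real.exp K * (1 + Real.exp K) * z.im / ‖(z : ℂ)‖ := by
    field_simp
  rw [e]
  constructor
  · rw [neg_le, neg_sub]
    refine (lg _ _ hz hw).trans ?_
    rw [div_le_div_iff₀ hw hz]
    have a1 : (‖(z : ℂ)‖ - ‖(w : ℂ)‖) * ‖(z : ℂ)‖ ≤ Real.exp K * z.im * ‖(z : ℂ)‖ :=
      mul_le_mul_of_nonneg_right n1'.2 hz.le
    have a2 : Real.exp K * z.im * ‖(z : ℂ)‖ ≤ Real.exp K * z.im * ((1 + Real.exp K) * ‖(w : ℂ)‖) :=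
      mul_le_mul_of_nonneg_left n2 (by positivity)
    nlinarith
  · refine (lg _ _ hw hz).trans ?_
    rw [div_le_div_iff_of_pos_right hz]
    nlinarith [mul_pos (mul_pos hE hE) h1]

/-! ### Rotations about `i`: the parameter `θ` turns directions by the angle `2 θ`. -/

/-- The rotation about `i` with parameter `θ`. -/
def rotI (θ : ℝ) : SL(2, ℝ) :=
  ⟨!![Real.cos θ, Real.sin θ; -Real.sin θ, Real.cos θ], by
    rw [Matrix.det_fin_two_of]
    nlinarith [Real.sin_sq_add_cos_sq θ]⟩

lemma coe_rotI_smul (θ : ℝ) (z : ℍ) : ((rotI θ • z : ℍ) : ℂ) =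
    (Real.cos θ * z + Real.sin θ) / (-Real.sin θ * z + Real.cos θ) := by
  rw [UpperHalfPlane.coe_specialLinearGroup_apply]
  simp [rotI]

lemma SL_im_smul (g : SL(2, ℝ)) (z : ℍ) : (g • z).im
    = z.im / ‖(g 1 0 * z + g 1 1 : ℂ)‖ ^ 2 := by
  have h := UpperHalfPlane.im_smul_eq_div_normSq (Matrix.SpecialLinearGroup.toGL g) z
  rw [Complex.sq_norm]
  have e : (Matrix.SpecialLinearGroup.toGL g • z).im = (g • z).im := rfl
  rw [← e, h]
  simp [UpperHalfPlane.denom]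

lemma SL_denom_ne_zero (g : SL(2, ℝ)) (z : ℍ) : (g 1 0 * z + g 1 1 : ℂ) ≠ 0 := by
  have h := UpperHalfPlane.denom_ne_zero (Matrix.SpecialLinearGroup.toGL g) z
  simpa [UpperHalfPlane.denom] using h

lemma SL_norm_smul (g : SL(2, ℝ)) (z : ℍ) : ‖((g • z : ℍ) : ℂ)‖
    = ‖(g 0 0 * z + g 0 1 : ℂ)‖ / ‖(g 1 0 * z + g 1 1 : ℂ)‖ := by
  rw [UpperHalfPlane.coe_specialLinearGroup_apply, norm_div]
  rfl

lemma axisRatio_smul (g : SL(2, ℝ)) (z : ℍ) : axisRatio (g • z)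
    = ‖(g 0 0 * z + g 0 1 : ℂ)‖ * ‖(g 1 0 * z + g 1 1 : ℂ)‖ / z.im := by
  have h1 := norm_pos_iff.2 (SL_denom_ne_zero g z)
  have h2 := z.im_pos
  rw [axisRatio, SL_im_smul, SL_norm_smul]
  field_simp

lemma axisRatio_rotI_smul (θ : ℝ) (z : ℍ) : axisRatio (rotI θ • z)
    = ‖(Real.cos θ * z + Real.sin θ : ℂ)‖ * ‖(-Real.sin θ * z + Real.cos θ : ℂ)‖ / z.im := by
  rw [axisRatio_smul]
  simp [rotI]

lemma re_rotI_smul (θ : ℝ) (z : ℍ) : (rotI θ • z : ℍ).re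
    = ((Real.cos θ ^ 2 - Real.sin θ ^ 2) * z.re
        + Real.sin θ * Real.cos θ * (1 - ‖(z : ℂ)‖ ^ 2))
      / ‖(-Real.sin θ * z + Real.cos θ : ℂ)‖ ^ 2 := by
  rw [← UpperHalfPlane.coe_re, coe_rotI_smul, Complex.div_re, UpperHalfPlane.norm_sq_eq,
    Complex.sq_norm, ← add_div]
  congr 1
  simp only [Complex.add_re, Complex.add_im, Complex.mul_re, Complex.mul_im, Complex.neg_re,
    Complex.neg_im, Complex.ofReal_re, Complex.ofReal_im, UpperHalfPlane.coe_re,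
    UpperHalfPlane.coe_im]
  ring

lemma rotI_smul_I (θ : ℝ) : rotI θ • UpperHalfPlane.I = UpperHalfPlane.I := by
  apply UpperHalfPlane.ext
  rw [coe_rotI_smul, UpperHalfPlane.coe_I, div_eq_iff]
  · linear_combination (Real.sin θ : ℂ) * Complex.I_sq
  · intro h
    have h1 := congrArg Complex.re h
    have h2 := congrArg Complex.im h
    simp only [Complex.add_re, Complex.add_im,
      Complex.mul_re, Complex.mul_im, Complex.neg_re, Complex.neg_im, Complex.ofReal_re,
      Complex.ofReal_im, Complex.I_re, Complex.I_im, Complex.zero_re, Complex.zero_im] at h1 h2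
    nlinarith [Real.sin_sq_add_cos_sq θ]

/-- At `θ = π / 2` the rotation is the half turn `z ↦ -1 / z`, which reverses the axis and so
exchanges its two halves. -/
lemma rotI_quarter_smul (z : ℍ) :
    ‖((rotI (Real.pi / 2) • z : ℍ) : ℂ)‖ = ‖(z : ℂ)‖⁻¹ ∧
      axisRatio (rotI (Real.pi / 2) • z) = axisRatio z := by
  constructor
  · rw [coe_rotI_smul]
    simp
  · rw [axisRatio_rotI_smul, axisRatio]
    simp

lemma axisProj_rotI_quarter_smul (z : ℍ) :
    axisProj (rotI (Real.pi / 2) • z) = - axisProj z := by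
  rw [axisProj, (rotI_quarter_smul z).1, Real.log_inv, axisProj]

lemma rotI_quarter_smul_axisPt (t : ℝ) : rotI (Real.pi / 2) • axisPt t = axisPt (-t) := by
  apply UpperHalfPlane.eq_of_re_of_norm
  · rw [re_rotI_smul]
    simp
  · rw [(rotI_quarter_smul _).1, norm_axisPt, norm_axisPt, Real.exp_neg]

/-- Every point of the plane lies on the axis after a rotation about `i`. -/
lemma exists_rotI_smul_re_eq_zero (z : ℍ) :
    ∃ θ ∈ Set.Icc 0 (Real.pi / 2), (rotI θ • z : ℍ).re = 0 := by
  -- The numerator of the real part of the rotated point changes sign over a half turn.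
  let F : ℝ → ℝ := fun θ => (Real.cos θ ^ 2 - Real.sin θ ^ 2) * z.re
        + Real.sin θ * Real.cos θ * (1 - ‖(z : ℂ)‖ ^ 2)
  have hF : Continuous F := by fun_prop
  have h0 : F 0 = z.re := by simp [F]
  have h1 : F (Real.pi / 2) = - z.re := by simp [F]
  have hpi : (0 : ℝ) ≤ Real.pi / 2 := by positivity
  have : ∃ θ ∈ Set.Icc 0 (Real.pi / 2), F θ = 0 := by
    rcases le_total 0 z.re with h | h
    · exact intermediate_value_Icc' hpi hF.continuousOn ⟨by rw [h1]; linarith, by rwa [h0]⟩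
    · exact intermediate_value_Icc hpi hF.continuousOn ⟨by rwa [h0], by rw [h1]; linarith⟩
  obtain ⟨θ, hθ, h⟩ := this
  refine ⟨θ, hθ, ?_⟩
  rw [re_rotI_smul]
  simp only [F] at h
  rw [h, zero_div]

lemma axisRatio_of_re_eq_zero {z : ℍ} (h : z.re = 0) : axisRatio z = 1 := by
  have e := z.norm_sq_eq
  rw [h] at e
  have : ‖(z : ℂ)‖ = z.im := (sq_eq_sq₀ (norm_nonneg _) z.im_pos.le).1 (by rw [e]; ring)
  rw [axisRatio, this, div_self z.im_ne_zero]

lemma axisRatio_rotI_eighth_smul (z : ℍ) : axisRatio (rotI (Real.pi / 4) • z)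
    = ‖((z : ℂ) ^ 2 - 1)‖ / (2 * z.im) := by
  rw [axisRatio_rotI_smul, Real.cos_pi_div_four, Real.sin_pi_div_four, ← norm_mul]
  have e : ((√2 / 2 : ℝ) * (z : ℂ) + (√2 / 2 : ℝ)) * (-(√2 / 2 : ℝ) * (z : ℂ) + (√2 / 2 : ℝ))
      = -(1 / 2) * ((z : ℂ) ^ 2 - 1) := by
    have : ((√2 / 2 : ℝ) : ℂ) ^ 2 = 1 / 2 := by
      rw [← Complex.ofReal_pow, div_pow, Real.sq_sqrt (by norm_num)]
      norm_num
    linear_combination (1 - (z : ℂ) ^ 2) * this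
  rw [e, norm_mul]
  simp
  ring

/-- A point near both the axis and its image under a quarter turn is near `i`. -/
lemma dist_I_le_of_axisRatio_le {z : ℍ} {C : ℝ} (h1 : axisRatio z ≤ C)
    (h2 : axisRatio (rotI (Real.pi / 4) • z) ≤ C) :
    dist z UpperHalfPlane.I ≤ Real.log (4 * C) := by
  have hC : 1 ≤ C := (one_le_axisRatio z).trans h1
  have e : (4 : ℝ) * C = 2 * (2 * C) := by ring
  rw [e]
  apply le_log_of_cosh_le
  rw [axisRatio_rotI_eighth_smul, div_le_iff₀ (by linarith [z.im_pos])] at h2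
  rw [axisRatio, div_le_iff₀ z.im_pos] at h1
  have hy := z.im_pos
  have hn := z.norm_pos
  rw [← axisPt_zero, cosh_dist_axisPt, Real.exp_zero, div_le_iff₀ (by linarith)]
  have h3 : |‖(z : ℂ)‖ ^ 2 - 1| ≤ C * (2 * z.im) := by
    refine le_trans ?_ h2
    have := abs_norm_sub_norm_le ((z : ℂ) ^ 2) 1
    rwa [norm_pow, norm_one] at this
  rw [abs_le] at h3
  have hyn : z.im ≤ ‖(z : ℂ)‖ := (le_abs_self _).trans (Complex.abs_im_le_norm _)
  -- Write `‖z‖² + 1` as `|‖z‖² - 1|` plus twice the smaller of `1` and `‖z‖²`; that smaller term is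
  -- at most `‖z‖ ≤ C * z.im`.
  rcases le_total 1 ‖(z : ℂ)‖ with h | h
  · nlinarith
  · nlinarith

lemma SL_dist_smul (g : SL(2, ℝ)) (z w : ℍ) : dist (g • z) (g • w) = dist z w := dist_smul g z w

lemma exists_SL_smul_I (z : ℍ) : ∃ g : SL(2, ℝ), g • UpperHalfPlane.I = z :=
  MulAction.exists_smul_eq SL(2, ℝ) UpperHalfPlane.I z

/-! ### Coarsely inverse pairs of coarsely Lipschitz maps -/

/-- `f` is coarsely Lipschitz, with the same multiplicative and additive constant. -/
def CoarseLip {X Y : Type*} [MetricSpace X] [MetricSpace Y] (L : ℝ) (f : X → Y) : Prop :=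
  ∀ x y, dist (f x) (f y) ≤ L * dist x y + L

/-- `f` and `g` are coarsely Lipschitz and coarsely inverse to each other. -/
structure CoarseInverses {X Y : Type*} [MetricSpace X] [MetricSpace Y] (L : ℝ) (f : X → Y)
    (g : Y → X) : Prop where
  lip : CoarseLip L f
  lip' : CoarseLip L g
  left_inv : ∀ x, dist (g (f x)) x ≤ L
  right_inv : ∀ y, dist (f (g y)) y ≤ L

namespace CoarseInverses

variable {X Y : Type*} [MetricSpace X] [MetricSpace Y] {L : ℝ} {f : X → Y} {g : Y → X}

lemma symm (h : CoarseInverses L f g) : CoarseInverses L g f :=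
  ⟨h.lip', h.lip, h.right_inv, h.left_inv⟩

lemma dist_le (h : CoarseInverses L f g) (x y : X) :
    dist x y ≤ L * dist (f x) (f y) + 3 * L := by
  have h1 := h.lip' (f x) (f y)
  have h2 := h.left_inv x
  have h3 := h.left_inv y
  have h4 := dist_triangle4 x (g (f x)) (g (f y)) y
  rw [dist_comm x (g (f x))] at h4
  linarith

lemma conj (h : CoarseInverses L f g) {X' Y' : Type*} [MetricSpace X'] [MetricSpace Y']
    (e : X' ≃ᵢ X) (e' : Y' ≃ᵢ Y) :
    CoarseInverses L (fun x => e'.symm (f (e x))) (fun y => e.symm (g (e' y))) := by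
  refine ⟨fun x y => ?_, fun x y => ?_, fun x => ?_, fun y => ?_⟩
  · rw [e'.symm.isometry.dist_eq, ← e.isometry.dist_eq]
    exact h.lip _ _
  · rw [e.symm.isometry.dist_eq, ← e'.isometry.dist_eq]
    exact h.lip' _ _
  · rw [← e.isometry.dist_eq, e'.apply_symm_apply, e.apply_symm_apply]
    exact h.left_inv _
  · rw [← e'.isometry.dist_eq, e.apply_symm_apply, e'.apply_symm_apply]
    exact h.right_inv _

end CoarseInverses

/-! ### The geometry of `ℍ × ℝ` -/

/-- The point of `ℍ × ℝ` with given coordinates. -/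
def hypPt (z : ℍ) (t : ℝ) : HypPlaneTimesReal := WithLp.toLp 2 (z, t)

@[simp] lemma hypPt_fst (z : ℍ) (t : ℝ) : (hypPt z t).fst = z := rfl

@[simp] lemma hypPt_snd (z : ℍ) (t : ℝ) : (hypPt z t).snd = t := rfl

lemma hypPt_fst_snd (x : HypPlaneTimesReal) : hypPt x.fst x.snd = x := rfl

lemma HypPlaneTimesReal.dist_eq (x y : HypPlaneTimesReal) :
    dist x y = √(dist x.fst y.fst ^ 2 + |x.snd - y.snd| ^ 2) := by
  rw [WithLp.prod_dist_eq_add (by norm_num), Real.sqrt_eq_rpow, Real.dist_eq]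
  simp

lemma dist_fst_le (x y : HypPlaneTimesReal) : dist x.fst y.fst ≤ dist x y := by
  rw [HypPlaneTimesReal.dist_eq]
  exact Real.le_sqrt_of_sq_le (by nlinarith [sq_nonneg |x.snd - y.snd|])

lemma abs_snd_sub_le (x y : HypPlaneTimesReal) : |x.snd - y.snd| ≤ dist x y := by
  rw [HypPlaneTimesReal.dist_eq]
  exact Real.le_sqrt_of_sq_le (by nlinarith [sq_nonneg (dist x.fst y.fst)])

lemma dist_le_fst_add_snd (x y : HypPlaneTimesReal) :
    dist x y ≤ dist x.fst y.fst + |x.snd - y.snd| := by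
  rw [HypPlaneTimesReal.dist_eq]
  have h1 : 0 ≤ dist x.fst y.fst := dist_nonneg
  have h2 := abs_nonneg (x.snd - y.snd)
  exact Real.sqrt_le_iff.2 ⟨by positivity, by nlinarith⟩


/-- The isometry of `ℍ × ℝ` given by a Möbius transformation and a translation. -/
def hypIso (γ : SL(2, ℝ)) (τ : ℝ) : HypPlaneTimesReal ≃ᵢ HypPlaneTimesReal where
  toFun x := hypPt (γ • x.fst) (x.snd + τ)
  invFun x := hypPt (γ⁻¹ • x.fst) (x.snd - τ)
  left_inv x := by
    dsimp only
    rw [hypPt_fst, hypPt_snd, inv_smul_smul, add_sub_cancel_right, hypPt_fst_snd]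
  right_inv x := by
    dsimp only
    rw [hypPt_fst, hypPt_snd, smul_inv_smul, sub_add_cancel, hypPt_fst_snd]
  isometry_toFun := Isometry.of_dist_eq fun x y => by
    rw [HypPlaneTimesReal.dist_eq, HypPlaneTimesReal.dist_eq, hypPt_fst, hypPt_fst, hypPt_snd,
      hypPt_snd, SL_dist_smul, add_sub_add_right_eq_sub]

@[simp] lemma hypIso_apply_fst (γ : SL(2, ℝ)) (τ : ℝ) (x : HypPlaneTimesReal) :
    (hypIso γ τ x).fst = γ • x.fst := rfl

@[simp] lemma hypIso_apply_snd (γ : SL(2, ℝ)) (τ : ℝ) (x : HypPlaneTimesReal) :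
    (hypIso γ τ x).snd = x.snd + τ := rfl

@[simp] lemma hypIso_symm_apply_fst (γ : SL(2, ℝ)) (τ : ℝ) (x : HypPlaneTimesReal) :
    ((hypIso γ τ).symm x).fst = γ⁻¹ • x.fst := rfl

lemma dist_hypPt_axisPt_le (a a' t t' : ℝ) :
    dist (hypPt (axisPt a) t) (hypPt (axisPt a') t') ≤ |a - a'| + |t - t'| := by
  refine (dist_le_fst_add_snd _ _).trans ?_
  rw [hypPt_fst, hypPt_fst, dist_axisPt, hypPt_snd, hypPt_snd]

lemma dist_hypPt_same_fst (z : ℍ) (t t' : ℝ) : dist (hypPt z t) (hypPt z t') = |t - t'| := by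
  rw [HypPlaneTimesReal.dist_eq, hypPt_fst, hypPt_fst, hypPt_snd, hypPt_snd, dist_self]
  simp [Real.sqrt_sq_eq_abs]

/-- The restriction of a coarsely Lipschitz bijection with small horizontal displacement to a
vertical line is coarsely monotone. -/
lemma vertical_orientation {L : ℝ} (hL : 1 ≤ L) {B V : ℝ} (hLB : L ≤ B) (hV : 20 * L ^ 2 * B ≤ V)
    {g g' : HypPlaneTimesReal → HypPlaneTimesReal} (hg : CoarseInverses L g g')
    (hB : ∀ x, dist (g x).fst x.fst ≤ B) (z : ℍ) (s : ℝ) (hs : |(g (hypPt z s)).snd| ≤ 3 * L * B) :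
    ∃ σ : ℝ, |σ| = 1 ∧ 12 * L * B ≤ (g (hypPt z (s + σ * V))).snd ∧
      (g (hypPt z (s - σ * V))).snd ≤ -(12 * L * B) := by
  have hB0 : 0 < B := by linarith
  have hLB0 : 0 < L * B := by positivity
  have hV0 : 0 ≤ V := le_trans (by positivity) hV
  -- Points `V` apart have images far apart, and at most `2 B` of that distance can be horizontal,
  -- so the heights must separate. The bound `15 L B` leaves `12 L B` after subtracting the height
  -- `3 L B` at `s`.
  have hbig : ∀ a b, V ≤ |a - b| →
      15 * L * B ≤ |(g (hypPt z a)).snd - (g (hypPt z b)).snd| := by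
    intro a b hab
    have h1 := hg.dist_le (hypPt z a) (hypPt z b)
    rw [dist_hypPt_same_fst] at h1
    have h2 := dist_le_fst_add_snd (g (hypPt z a)) (g (hypPt z b))
    have h3 := hB (hypPt z a)
    have h4 := hB (hypPt z b)
    have h5 := dist_triangle_right (g (hypPt z a)).fst (g (hypPt z b)).fst z
    rw [hypPt_fst] at h3 h4
    have h6 : dist (g (hypPt z a)) (g (hypPt z b))
        ≤ 2 * B + |(g (hypPt z a)).snd - (g (hypPt z b)).snd| := by linarith
    have h7 := mul_le_mul_of_nonneg_left h6 (by linarith : 0 ≤ L)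
    by_contra! h8
    have h9 := mul_le_mul_of_nonneg_left h8.le (by linarith : 0 ≤ L)
    have h10 : L * B ≤ L ^ 2 * B := by nlinarith
    have h11 : L ≤ L ^ 2 * B := by nlinarith
    nlinarith
  have hdich := coarsely_increasing_or_decreasing (fun t => (g (hypPt z t)).snd) (2 * L) V
    (by
      intro a b hab
      refine (abs_snd_sub_le _ _).trans ((hg.lip _ _).trans ?_)
      rw [dist_hypPt_same_fst]
      nlinarith)
    (by
      intro a b hab
      refine lt_of_lt_of_le ?_ (hbig a b hab)
      nlinarith) hV0
  have hs' := abs_le.1 hs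
  have e1 := hbig (s + V) s (by rw [add_sub_cancel_left]; exact le_abs_self V)
  have e2 := hbig s (s - V) (by rw [sub_sub_cancel]; exact le_abs_self V)
  rcases hdich with h | h
  · refine ⟨1, by simp, ?_⟩
    have h1 := h s (s + V) le_rfl
    have h2 := h (s - V) s (by linarith)
    rw [abs_of_pos (by linarith)] at e1 e2
    rw [one_mul]
    constructor <;> linarith
  · refine ⟨-1, by simp, ?_⟩
    have h1 := h s (s + V) le_rfl
    have h2 := h (s - V) s (by linarith)
    rw [abs_of_neg (by linarith)] at e1 e2
    rw [neg_one_mul, ← sub_eq_add_neg, sub_neg_eq_add]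
    constructor <;> linarith

/-- A coarsely Lipschitz bijection with horizontal displacement at most `B` maps some point of the
flat `axis × ℝ` to within distance `B / (32 L) + C` of the origin. The box in the flat around a
rough preimage of the origin is mapped over the origin with degree `± 1`, and the part of the box
mapped far away from the flat projects to a set of small area. -/
lemma exists_flat_point_near_origin {L : ℝ} (hL : 1 ≤ L) :
    ∃ C : ℝ, 0 ≤ C ∧ ∀ B : ℕ, L ≤ B → ∀ g g' : HypPlaneTimesReal → HypPlaneTimesReal,
      CoarseInverses L g g' → (∀ x, dist (g x).fst x.fst ≤ B) →
      (∀ x, dist (g' x).fst x.fst ≤ B) →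
      ∃ a t, dist (g (hypPt (axisPt a) t)) (hypPt (axisPt 0) 0) ≤ B / (32 * L) + C := by
  have hL0 : 0 < L := by linarith
  set c : ℕ := ⌈20 * L ^ 2⌉₊ with hc
  have hc1 : 20 * L ^ 2 ≤ c := Nat.le_ceil _
  set E := Real.exp (3 * L) * (1 + Real.exp (3 * L)) with hE
  have hE0 : 0 < E := by positivity
  set η := 1 / (64 * L) with hη
  have hη0 : 0 < η := by positivity
  have hη1 : η ≤ 1 / 64 := by
    rw [hη]
    exact one_div_le_one_div_of_le (by norm_num) (by linarith)
  -- Chosen so that `4 η² ρ` exceeds `96 c E L`, the constant of the final area comparison.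
  set ρ := 24 * c * E * L / η ^ 2 + 1 with hρ
  have hρ1 : 1 ≤ ρ := by
    have : 0 ≤ 24 * c * E * L / η ^ 2 := by positivity
    linarith
  have hlog : 0 ≤ Real.log (2 * ρ) := Real.log_nonneg (by linarith)
  refine ⟨Real.log (2 * ρ) + 6 * L, by linarith, ?_⟩
  intro B hLB g g' hg hB hB'
  have hB0 : (0 : ℝ) < B := by linarith
  have hLB0 : 0 < L * B := by positivity
  by_contra! hno
  set o := hypPt (axisPt 0) 0 with ho
  -- The point of the flat above `i` at this height is within `B` of `g' o`, so its image is near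
  -- the origin and the box below is centred on it.
  set s := (g' o).snd with hs
  set V : ℕ := c * B with hV
  have hVc : (V : ℝ) = c * B := by rw [hV]; push_cast; ring
  have hs0 : dist (g (hypPt (axisPt 0) s)) o ≤ L * B + 2 * L := by
    have h1 : dist (hypPt (axisPt 0) s) (g' o) ≤ B := by
      refine (dist_le_fst_add_snd _ _).trans ?_
      have := hB' o
      rw [dist_comm] at this
      rw [hypPt_snd, hypPt_fst, ← hs, sub_self, abs_zero, add_zero]
      exact this
    have h2 := hg.lip (hypPt (axisPt 0) s) (g' o)
    have h3 := hg.right_inv o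
    have h4 := dist_triangle (g (hypPt (axisPt 0) s)) (g (g' o)) o
    have h5 := mul_le_mul_of_nonneg_left h1 hL0.le
    linarith
  have hs1 : |(g (hypPt (axisPt 0) s)).snd| ≤ 3 * L * B := by
    have h := (abs_snd_sub_le _ _).trans hs0
    rw [ho, hypPt_snd, sub_zero] at h
    nlinarith
  obtain ⟨σ, hσ, htopq, hbotq⟩ := vertical_orientation hL (V := V) hLB
    (by rw [hVc]; exact mul_le_mul_of_nonneg_right hc1 hB0.le) hg hB (axisPt 0) s hs1
  -- A unit grid on a box of half-width `2 B` and half-height `V`. Displacement at most `B` keeps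
  -- the left and right sides outside `|p| < B`; the orientation sign `σ` makes the bottom go down
  -- and the top go up.
  let v : ℕ → ℕ → HypPlaneTimesReal := fun i j =>
    hypPt (axisPt (i - 2 * B)) (s + σ * (j - V))
  let p : ℕ → ℕ → ℝ := fun i j => axisProj (g (v i j)).fst
  let q : ℕ → ℕ → ℝ := fun i j => (g (v i j)).snd
  have hp : ∀ i j, |p i j - (i - 2 * B)| ≤ B := by
    intro i j
    have h1 := abs_axisProj_sub_le (g (v i j)).fst (axisPt (i - 2 * B))
    rw [axisProj_axisPt] at h1
    exact h1.trans (hB (v i j))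
  have hq : ∀ i j, i ≤ 4 * B →
      |q i j - (g (hypPt (axisPt 0) (s + σ * (j - V)))).snd| ≤ 3 * L * B := by
    intro i j hi
    refine (abs_snd_sub_le _ _).trans ((hg.lip _ _).trans ?_)
    have h1 := dist_hypPt_axisPt_le (i - 2 * B : ℝ) 0 (s + σ * (j - V)) (s + σ * (j - V))
    rw [sub_self, abs_zero, add_zero, sub_zero] at h1
    have h2 : |(i : ℝ) - 2 * B| ≤ 2 * B := by
      have : (i : ℝ) ≤ 4 * B := by exact_mod_cast hi
      have h0 : (0 : ℝ) ≤ i := Nat.cast_nonneg i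
      rw [abs_le]
      constructor <;> linarith
    have h3 := mul_le_mul_of_nonneg_left (h1.trans h2) hL0.le
    nlinarith
  have hadj : ∀ i j, ∀ a ∈ ({0, 1} : Finset ℕ), ∀ b ∈ ({0, 1} : Finset ℕ),
      dist (g (v (i + a) (j + b))) (g (v i j)) ≤ 3 * L := by
    intro i j a ha b hb
    refine (hg.lip _ _).trans ?_
    have h1 := dist_hypPt_axisPt_le ((i + a : ℕ) - 2 * B : ℝ) (i - 2 * B)
      (s + σ * ((j + b : ℕ) - V)) (s + σ * (j - V))
    have e1 : ((i + a : ℕ) - 2 * B : ℝ) - (i - 2 * B) = a := by push_cast; ring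
    have e2 : s + σ * (((j + b : ℕ) : ℝ) - V) - (s + σ * (j - V)) = σ * b := by push_cast; ring
    rw [e1, e2, abs_mul, hσ, one_mul, Nat.abs_cast, Nat.abs_cast] at h1
    have ha' : (a : ℝ) ≤ 1 := by
      simp only [Finset.mem_insert, Finset.mem_singleton] at ha
      rcases ha with rfl | rfl <;> simp
    have hb' : (b : ℝ) ≤ 1 := by
      simp only [Finset.mem_insert, Finset.mem_singleton] at hb
      rcases hb with rfl | rfl <;> simp
    have h2 : dist (v (i + a) (j + b)) (v i j) ≤ 2 := by
      refine h1.trans ?_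
      linarith
    nlinarith
  -- A grid point projecting close to the target square cannot be near the flat, for then it would
  -- be near the origin, against the assumption. The margin `3 L` passes from the target point to a
  -- corner of its grid square.
  have hfar : ∀ i j, |p i j| ≤ η * B + 3 * L → |q i j| ≤ η * B + 3 * L →
      ρ < axisRatio (g (v i j)).fst := by
    intro i j h1 h2
    by_contra! h3
    have h4 := hno (i - 2 * B) (s + σ * (j - V))
    have h5 := dist_le_fst_add_snd (g (v i j)) o
    have h6 := dist_axisPt_axisProj_le (g (v i j)).fst
    have h7 := dist_triangle (g (v i j)).fst (axisPt (p i j)) (axisPt 0)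
    rw [dist_axisPt, sub_zero] at h7
    have h8 : Real.log (2 * axisRatio (g (v i j)).fst) ≤ Real.log (2 * ρ) :=
      Real.log_le_log (by linarith [axisRatio_pos (g (v i j)).fst]) (by linarith)
    rw [ho, hypPt_fst, hypPt_snd, sub_zero] at h5
    have h9 : 2 * (η * B) = B / (32 * L) := by
      rw [hη]
      field_simp
      ring
    have h10 : dist (g (v i j)) (hypPt (axisPt 0) 0) ≤ B / (32 * L) + (Real.log (2 * ρ) + 6 * L) := by
      change |p i j| ≤ _ at h1
      change |(g (v i j)).snd| ≤ _ at h2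
      change dist _ (axisPt (p i j)) ≤ _ at h6
      linarith
    exact absurd h10 (not_le.2 h4)
  have hηB : η * B < B := by nlinarith
  have hηLB : η * B ≤ L * B := by nlinarith
  -- Each point of the square of half-side `η B` is straddled by the projected corners of a unit
  -- cell. Those cells are far from the flat, so their horizontal spread is only `E / ρ`, while the
  -- vertical spread stays at most `3 L`.
  have hcov := sq_le_of_covered_by_rectangles
    (Finset.range (4 * B) ×ˢ Finset.range (2 * V)) (fun x => p x.1 x.2) (fun x => q x.1 x.2)
    (η * B) (E / ρ) (3 * L) (by positivity) (by positivity) (by positivity) (by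
      intro y₁ y₂ hy₁ hy₂
      have hy₁' := abs_le.1 hy₁
      have hy₂' := abs_le.1 hy₂
      obtain ⟨i, hi, j, hj, a, ha, b, hb, a', ha', b', hb', d, hd, e, he, h1, h2, h3, h4⟩ :=
        exists_straddling_square p q (4 * B) (2 * V) y₁ y₂
        (fun j _ => by
          have := abs_le.1 (hp 0 j)
          rw [Nat.cast_zero] at this
          linarith)
        (fun j _ => by
          have := abs_le.1 (hp (4 * B) j)
          push_cast at this
          linarith)
        (fun i hi => by
          have := abs_le.1 (hq i 0 hi)
          rw [Nat.cast_zero, zero_sub, mul_neg, ← sub_eq_add_neg] at this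
          linarith)
        (fun i hi => by
          have := abs_le.1 (hq i (2 * V) hi)
          have e : s + σ * (((2 * V : ℕ) : ℝ) - V) = s + σ * V := by push_cast; ring
          rw [e] at this
          linarith)
      have p1 := abs_le.1 ((abs_axisProj_sub_le _ _).trans
        ((dist_fst_le _ _).trans (hadj i j a ha b hb)))
      have p2 := abs_le.1 ((abs_axisProj_sub_le _ _).trans
        ((dist_fst_le _ _).trans (hadj i j a' ha' b' hb')))
      have q1 := abs_le.1 ((abs_snd_sub_le _ _).trans (hadj i j a' ha' b' hb'))
      have q2 := abs_le.1 ((abs_snd_sub_le _ _).trans (hadj i j d hd e he))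
      change -(3 * L) ≤ p (i + a) (j + b) - p i j ∧ p (i + a) (j + b) - p i j ≤ 3 * L at p1
      change -(3 * L) ≤ p (i + a') (j + b') - p i j ∧ p (i + a') (j + b') - p i j ≤ 3 * L at p2
      change -(3 * L) ≤ q (i + a') (j + b') - q i j ∧ q (i + a') (j + b') - q i j ≤ 3 * L at q1
      change -(3 * L) ≤ q (i + d) (j + e) - q i j ∧ q (i + d) (j + e) - q i j ≤ 3 * L at q2
      have hr := hfar i j (abs_le.2 ⟨by linarith, by linarith⟩)
        (abs_le.2 ⟨by linarith, by linarith⟩)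
      have hEr : E / axisRatio (g (v i j)).fst ≤ E / ρ :=
        div_le_div_of_nonneg_left hE0.le (by linarith) hr.le
      have c1 := abs_le.1 ((abs_axisProj_sub_le_div (by
        rw [dist_comm]
        exact (dist_fst_le _ _).trans (hadj i j a ha b hb))).trans hEr)
      have c2 := abs_le.1 ((abs_axisProj_sub_le_div (by
        rw [dist_comm]
        exact (dist_fst_le _ _).trans (hadj i j a' ha' b' hb'))).trans hEr)
      change -(E / ρ) ≤ p (i + a) (j + b) - p i j ∧ p (i + a) (j + b) - p i j ≤ E / ρ at c1
      change -(E / ρ) ≤ p (i + a') (j + b') - p i j ∧ p (i + a') (j + b') - p i j ≤ E / ρ at c2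
      refine ⟨(i, j), Finset.mk_mem_product (Finset.mem_range.2 hi) (Finset.mem_range.2 hj),
        abs_le.2 ⟨?_, ?_⟩, abs_le.2 ⟨?_, ?_⟩⟩ <;> dsimp only <;> linarith)
  rw [Finset.card_product, Finset.card_range, Finset.card_range] at hcov
  push_cast at hcov
  rw [hVc] at hcov
  -- There are `8 c B²` cells. Both areas are thus quadratic in `B`, and a fixed `ρ` rules out every
  -- `B` at once.
  have e1 : 4 * (B : ℝ) * (2 * (c * B)) * (2 * (E / ρ) * (2 * (3 * L)))
      = (96 * c * E * L / ρ) * B ^ 2 := by ring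
  rw [e1] at hcov
  have e2 : 4 * η ^ 2 * (B : ℝ) ^ 2 ≤ (96 * c * E * L / ρ) * B ^ 2 := by linarith
  have e3 := le_of_mul_le_mul_right e2 (by positivity)
  rw [le_div_iff₀ (by linarith), hρ, mul_add, mul_one] at e3
  have e4 : 4 * η ^ 2 * (24 * c * E * L / η ^ 2) = 96 * c * E * L := by
    field_simp
    ring
  rw [e4] at e3
  have : 0 < η ^ 2 := by positivity
  linarith

/-- A coarsely Lipschitz bijection with bounded horizontal displacement has much smaller
horizontal displacement than the given bound, up to a uniform constant. -/
lemma horizontal_displacement_improve {L : ℝ} (hL : 1 ≤ L) :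
    ∃ C : ℝ, 0 ≤ C ∧ ∀ B : ℕ, L ≤ B → ∀ g g' : HypPlaneTimesReal → HypPlaneTimesReal,
      CoarseInverses L g g' → (∀ x, dist (g x).fst x.fst ≤ B) →
      (∀ x, dist (g' x).fst x.fst ≤ B) → ∀ x, dist (g x).fst x.fst ≤ B / 32 + C := by
  obtain ⟨C, hC, h⟩ := exists_flat_point_near_origin hL
  have hL0 : 0 < L := by linarith
  have hlog : 0 ≤ Real.log 4 := Real.log_nonneg (by norm_num)
  refine ⟨Real.log 4 + (L * C + 2 * L), by positivity, ?_⟩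
  intro B hLB g g' hg hB hB' x
  set r := (B : ℝ) / 32 + (L * C + 2 * L) with hr
  have key : ∀ γ : SL(2, ℝ), γ • UpperHalfPlane.I = x.fst →
      axisRatio (γ⁻¹ • (g x).fst) ≤ Real.exp r := by
    intro γ hγ
    set e := hypIso γ x.snd with he
    have hc := hg.conj e e
    have hBc : ∀ f : HypPlaneTimesReal → HypPlaneTimesReal, (∀ x, dist (f x).fst x.fst ≤ B) →
        ∀ y, dist (e.symm (f (e y))).fst y.fst ≤ B := by
      intro f hf y
      rw [he, hypIso_symm_apply_fst, ← SL_dist_smul γ, smul_inv_smul, ← hypIso_apply_fst γ x.snd y]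
      exact hf _
    -- The coarse inverse sends some flat point `v` near the origin. Applying `g` puts `g x` near
    -- the flat through `x`; the factor `1 / (32 L)` is there to absorb the Lipschitz constant `L`.
    obtain ⟨a, t, hat⟩ := h B hLB _ _ hc.symm (hBc g' hB') (hBc g hB)
    set v := hypPt (axisPt a) t
    set o := hypPt (axisPt 0) 0 with ho
    have heo : e o = x := by
      rw [← hypPt_fst_snd (e o), he, hypIso_apply_fst, hypIso_apply_snd, ho, hypPt_fst, hypPt_snd,
        axisPt_zero, hγ, zero_add, hypPt_fst_snd]
    have h1 := hc.lip o (e.symm (g' (e v)))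
    have h2 := hc.right_inv v
    have h3 := dist_triangle (e.symm (g (e o))) (e.symm (g (e (e.symm (g' (e v)))))) v
    rw [dist_comm] at hat
    have h4 := mul_le_mul_of_nonneg_left hat hL0.le
    have h5 : L * ((B : ℝ) / (32 * L) + C) = B / 32 + L * C := by
      field_simp
    have h6 : dist (e.symm (g (e o))) v ≤ r := by
      rw [hr]
      linarith
    have h7 := (dist_fst_le _ _).trans h6
    rw [heo, he, hypIso_symm_apply_fst] at h7
    exact (axisRatio_le_exp _ a).trans (Real.exp_le_exp.2 h7)
  obtain ⟨γ, hγ⟩ := exists_SL_smul_I x.fst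
  have h1 := key γ hγ
  -- The second geodesic through the same point is perpendicular to the first.
  have h2 := key (γ * (rotI (Real.pi / 4))⁻¹) (by
    rw [mul_smul, inv_smul_eq_iff.2 (rotI_smul_I _).symm, hγ])
  rw [mul_inv_rev, inv_inv, mul_smul] at h2
  have h3 := dist_I_le_of_axisRatio_le h1 h2
  rw [Real.log_mul (by norm_num) (Real.exp_pos r).ne', Real.log_exp, ← SL_dist_smul γ,
    smul_inv_smul, hγ] at h3
  linarith

/-! ### Conjugated vertical translations and the preservation of vertical lines. -/

/-- The vertical translation of `ℍ × ℝ`. -/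
def vertTrans (t : ℝ) (x : HypPlaneTimesReal) : HypPlaneTimesReal := hypPt x.fst (x.snd + t)

lemma dist_vertTrans (t : ℝ) (x y : HypPlaneTimesReal) :
    dist (vertTrans t x) (vertTrans t y) = dist x y := by
  rw [HypPlaneTimesReal.dist_eq, HypPlaneTimesReal.dist_eq]
  simp [vertTrans]

lemma dist_vertTrans_vertTrans (t t' : ℝ) (x : HypPlaneTimesReal) :
    dist (vertTrans t x) (vertTrans t' x) = |t - t'| := by
  rw [vertTrans, vertTrans, dist_hypPt_same_fst, add_sub_add_left_eq_sub]

lemma vertTrans_neg_vertTrans (t : ℝ) (x : HypPlaneTimesReal) :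
    vertTrans (-t) (vertTrans t x) = x := by
  simp [vertTrans, hypPt_fst_snd]

/-- Translations are isometries, so the constant does not depend on `t`; this uniformity allows the
bootstrap over all `t`. -/
lemma coarseInverses_vertTrans_conj {L : ℝ} (hL : 1 ≤ L)
    {f f' : HypPlaneTimesReal → HypPlaneTimesReal} (hf : CoarseInverses L f f') (t : ℝ) :
    CoarseInverses (5 * L ^ 2) (fun x => f (vertTrans t (f' x)))
      (fun x => f (vertTrans (-t) (f' x))) := by
  have hlip : ∀ t, CoarseLip (5 * L ^ 2) fun x => f (vertTrans t (f' x)) := by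
    intro t x y
    have h1 := hf.lip (vertTrans t (f' x)) (vertTrans t (f' y))
    rw [dist_vertTrans] at h1
    have h2 := mul_le_mul_of_nonneg_left (hf.lip' x y) (by linarith : 0 ≤ L)
    have h3 : 0 ≤ dist x y := dist_nonneg
    nlinarith [mul_nonneg (mul_self_nonneg L) h3]
  have hinv : ∀ t x, dist (f (vertTrans (-t) (f' (f (vertTrans t (f' x)))))) x ≤ 5 * L ^ 2 := by
    intro t x
    have h1 := hf.lip (vertTrans (-t) (f' (f (vertTrans t (f' x)))))
      (vertTrans (-t) (vertTrans t (f' x)))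
    rw [dist_vertTrans, vertTrans_neg_vertTrans] at h1
    have h2 := mul_le_mul_of_nonneg_left (hf.left_inv (vertTrans t (f' x))) (by linarith : 0 ≤ L)
    have h3 := hf.right_inv x
    have h4 := dist_triangle (f (vertTrans (-t) (f' (f (vertTrans t (f' x)))))) (f (f' x)) x
    nlinarith
  exact ⟨hlip t, hlip (-t), hinv t, fun x => by simpa using hinv (-t) x⟩

/-- Quasi-isometries of `ℍ × ℝ` almost preserve the vertical lines. -/
theorem exists_dist_fst_le {L : ℝ} (hL : 1 ≤ L) :
    ∃ D : ℝ, ∀ f f' : HypPlaneTimesReal → HypPlaneTimesReal, CoarseInverses L f f' →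
      ∀ z t t', dist (f (hypPt z t)).fst (f (hypPt z t')).fst ≤ D := by
  obtain ⟨C, hC, himp⟩ := horizontal_displacement_improve (L := 5 * L ^ 2) (by nlinarith)
  set l : ℕ := ⌈2 * L⌉₊
  have hl : 2 * L ≤ l := Nat.le_ceil _
  -- Large enough that `(B + l) / 32 + C ≤ B`: the loss `l` of one unit step is recovered by the
  -- improvement.
  set B : ℕ := ⌈5 * L ^ 2⌉₊ + 2 * ⌈C⌉₊ + l with hB
  have hB1 : 5 * L ^ 2 ≤ ⌈5 * L ^ 2⌉₊ := Nat.le_ceil _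
  have hB2 : C ≤ ⌈C⌉₊ := Nat.le_ceil _
  have hBr : (B : ℝ) = ⌈5 * L ^ 2⌉₊ + 2 * ⌈C⌉₊ + l := by rw [hB]; push_cast; ring
  refine ⟨B + L ^ 2 + L, ?_⟩
  intro f f' hf
  have hind : ∀ n : ℕ, ∀ t : ℝ, |t| ≤ n → ∀ x,
      dist (f (vertTrans t (f' x))).fst x.fst ≤ B := by
    intro n
    induction n with
    | zero =>
      intro t ht x
      rw [Nat.cast_zero] at ht
      have : t = 0 := abs_nonpos_iff.1 ht
      subst this
      have e : vertTrans 0 (f' x) = f' x := by simp [vertTrans, hypPt_fst_snd]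
      rw [e]
      have h1 := (dist_fst_le _ _).trans (hf.right_inv x)
      have h2 : (0 : ℝ) ≤ ⌈C⌉₊ := Nat.cast_nonneg _
      nlinarith
    | succ n ih =>
      have hstep : ∀ t : ℝ, |t| ≤ (n + 1 : ℕ) → ∀ x,
          dist (f (vertTrans t (f' x))).fst x.fst ≤ (B + l : ℕ) := by
        intro t ht x
        obtain ⟨t', ht', htt⟩ : ∃ t' : ℝ, |t'| ≤ n ∧ |t - t'| ≤ 1 := by
          rw [Nat.cast_add, Nat.cast_one, abs_le] at ht
          have hn : (0 : ℝ) ≤ n := Nat.cast_nonneg n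
          rcases le_total t (-n) with h | h
          · exact ⟨-n, by rw [abs_neg, Nat.abs_cast], abs_le.2 ⟨by linarith, by linarith⟩⟩
          rcases le_total t n with h' | h'
          · exact ⟨t, abs_le.2 ⟨h, h'⟩, by simp⟩
          · exact ⟨n, by rw [Nat.abs_cast], abs_le.2 ⟨by linarith, by linarith⟩⟩
        have h1 := ih t' ht' x
        have h2 := hf.lip (vertTrans t (f' x)) (vertTrans t' (f' x))
        rw [dist_vertTrans_vertTrans] at h2
        have h3 := (dist_fst_le _ _).trans h2
        have h4 := dist_triangle (f (vertTrans t (f' x))).fst (f (vertTrans t' (f' x))).fst x.fst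
        push_cast
        nlinarith
      intro t ht x
      have hci := coarseInverses_vertTrans_conj hL hf t
      have h1 := himp (B + l) (by push_cast; rw [hBr]; linarith) _ _ hci (hstep t ht)
        (hstep (-t) (by rwa [abs_neg])) x
      refine h1.trans ?_
      push_cast
      have h2 : (0 : ℝ) ≤ l := Nat.cast_nonneg l
      linarith
  intro z t t'
  -- The base point `f (z, t')` turns displacement under the conjugated translation into the
  -- distance between images of two points on one vertical line.
  have h1 := hind ⌈|t - t'|⌉₊ (t - t') (Nat.le_ceil _) (f (hypPt z t'))
  have e : vertTrans (t - t') (hypPt z t') = hypPt z t := by simp [vertTrans]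
  have h2 := hf.lip (vertTrans (t - t') (f' (f (hypPt z t')))) (vertTrans (t - t') (hypPt z t'))
  rw [dist_vertTrans, e] at h2
  have h3 := mul_le_mul_of_nonneg_left (hf.left_inv (hypPt z t')) (by linarith : 0 ≤ L)
  have h4 := dist_fst_le (f (vertTrans (t - t') (f' (f (hypPt z t'))))) (f (hypPt z t))
  have h5 := dist_triangle_left (f (hypPt z t)).fst (f (hypPt z t')).fst
    (f (vertTrans (t - t') (f' (f (hypPt z t'))))).fst
  nlinarith

/-! ### Stability of quasi-geodesics in the hyperbolic plane -/

/-- `f` is a coarse embedding with linear control in both directions. -/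
structure CoarseEmb {X Y : Type*} [MetricSpace X] [MetricSpace Y] (L : ℝ) (f : X → Y) : Prop where
  lip : CoarseLip L f
  lower : ∀ x y, dist x y ≤ L * dist (f x) (f y) + L

namespace CoarseEmb

variable {X Y Z : Type*} [MetricSpace X] [MetricSpace Y] [MetricSpace Z] {L : ℝ} {f : X → Y}

lemma comp_isometry (h : CoarseEmb L f) {e : Z → X} (he : Isometry e) :
    CoarseEmb L (fun x => f (e x)) :=
  ⟨fun x y => by rw [← he.dist_eq]; exact h.lip _ _,
    fun x y => by rw [← he.dist_eq]; exact h.lower _ _⟩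

lemma isometry_comp (h : CoarseEmb L f) {e : Y → Z} (he : Isometry e) :
    CoarseEmb L (fun x => e (f x)) :=
  ⟨fun x y => by rw [he.dist_eq]; exact h.lip _ _,
    fun x y => by rw [he.dist_eq]; exact h.lower _ _⟩

end CoarseEmb

lemma CoarseInverses.coarseEmb {X Y : Type*} [MetricSpace X] [MetricSpace Y] {L : ℝ} (hL : 1 ≤ L)
    {f : X → Y} {g : Y → X} (h : CoarseInverses L f g) : CoarseEmb (3 * L) f :=
  ⟨fun x y => by
    have h1 := h.lip x y
    have h2 : 0 ≤ dist x y := dist_nonneg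
    nlinarith, fun x y => by
    have h1 := h.dist_le x y
    have h2 : 0 ≤ dist (f x) (f y) := dist_nonneg
    nlinarith⟩

lemma coarseEmb_isometry {X Y : Type*} [MetricSpace X] [MetricSpace Y] {f : X → Y}
    (hf : Isometry f) : CoarseEmb 1 f :=
  ⟨fun x y => by rw [hf.dist_eq]; linarith, fun x y => by rw [hf.dist_eq]; linarith⟩

/-- The contraction constant of the projection to the axis for steps of length `2 L`. -/
def contractionConst (L : ℝ) : ℝ := 2 * L * (Real.exp (2 * L) * (1 + Real.exp (2 * L)))

lemma contractionConst_pos {L : ℝ} (hL : 1 ≤ L) : 0 < contractionConst L := by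
  have : 0 < L := by linarith
  unfold contractionConst
  positivity

lemma CoarseEmb.dist_succ_le {L : ℝ} {q : ℕ → ℍ} (hq : CoarseEmb L q) (k : ℕ) :
    dist (q k) (q (k + 1)) ≤ 2 * L := by
  have := hq.lip k (k + 1)
  rw [Nat.dist_eq] at this
  have e : ((k : ℝ) - (k + 1 : ℕ)) = -1 := by push_cast; ring
  rw [e, abs_neg, abs_one] at this
  linarith

/-- Beyond the radius set by `contractionConst`, each step advances the projection by at most `1 /
(2 L)`. -/
lemma abs_axisProj_sub_le_of_far {L ρ : ℝ} (hL : 1 ≤ L) (hρ : contractionConst L ≤ ρ) {q : ℕ → ℍ}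
    (hq : CoarseEmb L q) (i n : ℕ) (hfar : ∀ k < n, ρ ≤ axisRatio (q (i + k))) :
    |axisProj (q (i + n)) - axisProj (q i)| ≤ n / (2 * L) := by
  have hL0 : 0 < L := by linarith
  induction n with
  | zero => simp
  | succ n ih =>
    have h1 := ih fun k hk => hfar k (Nat.lt_succ_of_lt hk)
    have h2 := abs_axisProj_sub_le_div (hq.dist_succ_le (i + n))
    have h3 : Real.exp (2 * L) * (1 + Real.exp (2 * L)) / axisRatio (q (i + n)) ≤ 1 / (2 * L) := by
      rw [div_le_div_iff₀ (axisRatio_pos _) (by positivity), one_mul]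
      have := hρ.trans (hfar n (Nat.lt_succ_self n))
      unfold contractionConst at this
      linarith
    have h4 := abs_sub_le (axisProj (q (i + (n + 1)))) (axisProj (q (i + n))) (axisProj (q i))
    rw [← add_assoc] at h4 ⊢
    have e : ((n + 1 : ℕ) : ℝ) / (2 * L) = n / (2 * L) + 1 / (2 * L) := by push_cast; ring
    rw [e]
    linarith

/-- A quasi-geodesic must progress at rate about `1 / L`, but far from the axis its projection moves
at half that rate. The shortfall is paid by the distances of the two ends to the axis, which bounds
the length. -/
lemma length_le_of_far {L ρ : ℝ} (hL : 1 ≤ L) (hρ : contractionConst L ≤ ρ) {q : ℕ → ℍ}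
    (hq : CoarseEmb L q) (i n : ℕ) (hfar : ∀ k < n, ρ ≤ axisRatio (q (i + k))) :
    (n : ℝ) ≤ 2 * (L * (Real.log (2 * axisRatio (q i)) + Real.log (2 * axisRatio (q (i + n)))) + L)
    := by
  have hL0 : 0 < L := by linarith
  have h1 := abs_axisProj_sub_le_of_far hL hρ hq i n hfar
  have h2 := hq.lower i (i + n)
  rw [Nat.dist_eq] at h2
  have e : ((i : ℝ) - (i + n : ℕ)) = -n := by push_cast; ring
  rw [e, abs_neg, Nat.abs_cast] at h2
  have h3 := dist_triangle4 (q i) (axisPt (axisProj (q i))) (axisPt (axisProj (q (i + n))))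
    (q (i + n))
  rw [dist_axisPt, dist_comm (axisPt _) (q (i + n)), abs_sub_comm] at h3
  have h4 := dist_axisPt_axisProj_le (q i)
  have h5 := dist_axisPt_axisProj_le (q (i + n))
  have h6 : dist (q i) (q (i + n)) ≤ Real.log (2 * axisRatio (q i))
      + Real.log (2 * axisRatio (q (i + n))) + n / (2 * L) := by linarith
  have h7 := mul_le_mul_of_nonneg_left h6 hL0.le
  have h8 : L * (n / (2 * L)) = n / 2 := by field_simp
  nlinarith

/-- A quasi-geodesic segment whose endpoints are near the axis stays near the axis. -/
lemma exists_axisRatio_le_of_endpoints {L ρ : ℝ} (hL : 1 ≤ L) (hρ : contractionConst L ≤ ρ) :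
    ∃ R : ℝ, ∀ q : ℕ → ℍ, CoarseEmb L q → ∀ n, axisRatio (q 0) ≤ ρ → axisRatio (q n) ≤ ρ →
      ∀ k ≤ n, axisRatio (q k) ≤ R := by
  classical
  have hL0 : 0 < L := by linarith
  set N := 2 * (L * (Real.log (2 * (2 * Real.exp (2 * L) * ρ)) + Real.log (2 * ρ)) + L) with hN
  refine ⟨max ρ (2 * Real.exp (L * N + L) * ρ), ?_⟩
  intro q hq n h0 hn k hk
  by_cases hkρ : axisRatio (q k) ≤ ρ
  · exact hkρ.trans (le_max_left _ _)
  refine le_trans ?_ (le_max_right _ _)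
  have hρ0 : 0 < ρ := (contractionConst_pos hL).trans_le hρ
  have hex : ∃ j, k ≤ j ∧ axisRatio (q j) ≤ ρ := ⟨n, hk, hn⟩
  -- The excursion around `k`: `i` is the last near index before it and `j` the first after it. The
  -- far stretch starts at `i + 1`, whose ratio is still controlled because one step has length at
  -- most `2 L`.
  set j := Nat.find hex with hj
  obtain ⟨hkj, hjρ⟩ := Nat.find_spec hex
  rw [← hj] at hkj hjρ
  set i := Nat.findGreatest (fun i => axisRatio (q i) ≤ ρ) k with hi
  have hiρ : axisRatio (q i) ≤ ρ :=
    Nat.findGreatest_spec (P := fun i => axisRatio (q i) ≤ ρ) (Nat.zero_le k) h0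
  have hik : i ≤ k := Nat.findGreatest_le k
  have hik' : i < k := lt_of_le_of_ne hik fun h => hkρ (h ▸ hiρ)
  have hkj' : k < j := lt_of_le_of_ne hkj fun h => hkρ (h ▸ hjρ)
  have hfar : ∀ m, i < m → m < j → ρ < axisRatio (q m) := by
    intro m him hmj
    rw [← not_le]
    rcases le_total m k with h | h
    · exact Nat.findGreatest_is_greatest him h
    · intro h'
      exact Nat.find_min hex hmj ⟨h, h'⟩
  obtain ⟨m, hm⟩ := Nat.exists_eq_add_of_lt (hik'.trans hkj')
  have hm' : i + 1 + m = j := by omega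
  have h1 := length_le_of_far hL hρ hq (i + 1) m fun l hl =>
    (hfar _ (by omega) (by omega)).le
  rw [hm'] at h1
  have h2 : axisRatio (q (i + 1)) ≤ 2 * Real.exp (2 * L) * ρ := by
    refine (axisRatio_le_mul_axisRatio (q i) (q (i + 1))).trans ?_
    have h3 := hq.dist_succ_le i
    rw [dist_comm] at h3
    have h4 := Real.exp_le_exp.2 h3
    have h5 := axisRatio_pos (q i)
    have h6 := Real.exp_pos (dist (q (i + 1)) (q i))
    nlinarith
  have h3 := Real.log_le_log (by linarith [axisRatio_pos (q (i + 1))])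
    (mul_le_mul_of_nonneg_left h2 zero_le_two)
  have h4 := Real.log_le_log (by linarith [axisRatio_pos (q j)])
    (mul_le_mul_of_nonneg_left hjρ zero_le_two)
  have hmN : (m : ℝ) ≤ N := by
    rw [hN]
    nlinarith
  have h5 := hq.lip k j
  rw [Nat.dist_eq, abs_sub_comm] at h5
  have h6 : |(j : ℝ) - k| ≤ m := by
    have e1 : (k : ℝ) ≤ j := by exact_mod_cast hkj
    have e2 : (j : ℝ) ≤ k + m := by
      have : j ≤ k + m := by omega
      exact_mod_cast this
    rw [abs_of_nonneg (by linarith)]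
    linarith
  have h7 : dist (q k) (q j) ≤ L * N + L := by nlinarith
  refine (axisRatio_le_mul_axisRatio (q j) (q k)).trans ?_
  have h8 := Real.exp_le_exp.2 h7
  have h9 := axisRatio_pos (q j)
  have h10 := Real.exp_pos (dist (q k) (q j))
  nlinarith

/-- A stretch that is far but within bounded distance has bounded length, so an infinite one cannot
exist. -/
lemma exists_axisRatio_le_of_bounded {L ρ : ℝ} (hL : 1 ≤ L) (hρ : contractionConst L ≤ ρ)
    {q : ℕ → ℍ} (hq : CoarseEmb L q) {C : ℝ} (hC : ∀ n, axisRatio (q n) ≤ C) :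
    ∃ n, axisRatio (q n) ≤ ρ := by
  by_contra! h
  have hL0 : 0 < L := by linarith
  obtain ⟨n, hn⟩ := exists_nat_gt (2 * (L * (Real.log (2 * C) + Real.log (2 * C)) + L))
  have h1 := length_le_of_far hL hρ hq 0 n fun k _ => (h _).le
  have h2 := fun k => Real.log_le_log (by linarith [axisRatio_pos (q k)])
    (mul_le_mul_of_nonneg_left (hC k) zero_le_two)
  have h3 := h2 0
  have h4 := h2 (0 + n)
  nlinarith

/-- A quasi-geodesic line within finite distance of the axis is uniformly near the axis. -/
lemma exists_axisRatio_le_of_line {L : ℝ} (hL : 1 ≤ L) :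
    ∃ R : ℝ, ∀ q : ℤ → ℍ, CoarseEmb L q → (∃ C, ∀ n, axisRatio (q n) ≤ C) →
      ∀ n, axisRatio (q n) ≤ R := by
  obtain ⟨R, hR⟩ := exists_axisRatio_le_of_endpoints hL le_rfl
  refine ⟨R, ?_⟩
  rintro q hq ⟨C, hC⟩ n
  have hiso : ∀ m : ℤ, Isometry fun k : ℕ => m + (k : ℤ) := fun m => Isometry.of_dist_eq
    fun a b => by rw [Int.dist_eq, Nat.dist_eq]; push_cast; congr 1; ring
  have hiso' : ∀ m : ℤ, Isometry fun k : ℕ => m - (k : ℤ) := fun m => Isometry.of_dist_eq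
    fun a b => by rw [Int.dist_eq, Nat.dist_eq, abs_sub_comm]; push_cast; congr 1; ring
  -- Near points on both sides of `n` reduce to a finite segment; the qualitative bound `C` does not
  -- enter the resulting `R`.
  obtain ⟨j, hj⟩ := exists_axisRatio_le_of_bounded hL le_rfl (hq.comp_isometry (hiso n))
    fun _ => hC _
  obtain ⟨i, hi⟩ := exists_axisRatio_le_of_bounded hL le_rfl (hq.comp_isometry (hiso' n))
    fun _ => hC _
  have h := hR _ (hq.comp_isometry (hiso (n - i))) (i + j) (by simpa using hi)
    (by
      have e : n - (i : ℤ) + ((i + j : ℕ) : ℤ) = n + j := by push_cast; ring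
      rwa [e]) i (Nat.le_add_right _ _)
  simpa using h

lemma exists_near_positive_axis {q : ℕ → ℍ} {R : ℝ} (hR : ∀ n, axisRatio (q n) ≤ R) {n₀ : ℕ}
    (hpos : ∀ n ≥ n₀, 0 ≤ axisProj (q n)) :
    ∃ C, ∀ n, ∃ s : ℝ≥0, dist (q n) (axisPt s) ≤ C := by
  have hR1 : 1 ≤ R := (one_le_axisRatio _).trans (hR 0)
  have hlog : 0 ≤ Real.log (2 * R) := Real.log_nonneg (by linarith)
  refine ⟨Real.log (2 * R) + ∑ k ∈ Finset.range n₀, dist (q k) (axisPt 0), ?_⟩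
  intro n
  rcases lt_or_ge n n₀ with h | h
  · refine ⟨0, ?_⟩
    have := Finset.single_le_sum (f := fun k => dist (q k) (axisPt 0))
      (fun _ _ => dist_nonneg) (Finset.mem_range.2 h)
    rw [NNReal.coe_zero]
    linarith
  · refine ⟨NNReal.mk (axisProj (q n)) (hpos n h), ?_⟩
    have h1 := dist_axisPt_axisProj_le (q n)
    have h2 := Real.log_le_log (by linarith [axisRatio_pos (q n)])
      (mul_le_mul_of_nonneg_left (hR n) zero_le_two)
    have h3 : 0 ≤ ∑ k ∈ Finset.range n₀, dist (q k) (axisPt 0) :=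
      Finset.sum_nonneg fun _ _ => dist_nonneg
    rw [NNReal.coe_mk]
    linarith

/-- A quasi-geodesic ray is within bounded distance of a geodesic ray. -/
lemma exists_ray_near_nat {L : ℝ} (hL : 1 ≤ L) {q : ℕ → ℍ} (hq : CoarseEmb L q) :
    ∃ (γ : SL(2, ℝ)) (C : ℝ), ∀ n, ∃ s : ℝ≥0, dist (q n) (γ • axisPt s) ≤ C := by
  have hL0 : 0 < L := by linarith
  -- Rotations about `i` preserve the distance to `i`, so this makes `q 0` near the rotated axis for
  -- every angle.
  set ρ := contractionConst L + Real.exp (dist (q 0) UpperHalfPlane.I) + 1 with hρ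
  have hc := contractionConst_pos hL
  have he := Real.exp_pos (dist (q 0) UpperHalfPlane.I)
  obtain ⟨R, hR⟩ := exists_axisRatio_le_of_endpoints (ρ := ρ) hL (by linarith)
  have hrot : ∀ θ, CoarseEmb L fun k => rotI θ • q k := fun θ =>
    hq.isometry_comp (isometry_smul ℍ (rotI θ))
  have hrot0 : ∀ θ, axisRatio (rotI θ • q 0) ≤ ρ := by
    intro θ
    have h := axisRatio_le_exp (rotI θ • q 0) 0
    rw [axisPt_zero, ← rotI_smul_I θ, SL_dist_smul] at h
    linarith
  -- Angles for which the first `n` points stay near the axis. An angle placing `q n` on the axis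
  -- shows that `A n` is nonempty; compactness yields one angle valid for all `n`.
  let A : ℕ → Set ℝ := fun n =>
    Set.Icc 0 (Real.pi / 2) ∩ ⋂ k, ⋂ (_ : k ≤ n), {θ | axisRatio (rotI θ • q k) ≤ R}
  have hmem : ∀ n θ, θ ∈ A n ↔ θ ∈ Set.Icc 0 (Real.pi / 2) ∧
      ∀ k ≤ n, axisRatio (rotI θ • q k) ≤ R := by
    intro n θ
    simp [A]
  have hclosed : ∀ n, IsClosed (A n) := by
    intro n
    refine isClosed_Icc.inter (isClosed_iInter fun k => isClosed_iInter fun _ => ?_)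
    refine isClosed_le ?_ continuous_const
    simp only [axisRatio_rotI_smul]
    fun_prop
  have hne : ∀ n, (A n).Nonempty := by
    intro n
    obtain ⟨θ, hθ, hre⟩ := exists_rotI_smul_re_eq_zero (q n)
    refine ⟨θ, (hmem n θ).2 ⟨hθ, hR _ (hrot θ) n (hrot0 θ) ?_⟩⟩
    rw [axisRatio_of_re_eq_zero hre]
    linarith
  have hcomp : IsCompact (A 0) := isCompact_Icc.inter_right <| by
    refine isClosed_iInter fun k => isClosed_iInter fun _ => ?_
    refine isClosed_le ?_ continuous_const
    simp only [axisRatio_rotI_smul]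
    fun_prop
  obtain ⟨θ, hθ⟩ := IsCompact.nonempty_iInter_of_sequence_nonempty_isCompact_isClosed A
    (fun n θ h => (hmem _ _).2 ⟨((hmem _ _).1 h).1, fun k hk =>
      ((hmem _ _).1 h).2 k (hk.trans (Nat.le_succ n))⟩) hne hcomp hclosed
  have hθR : ∀ n, axisRatio (rotI θ • q n) ≤ R := fun n =>
    ((hmem n θ).1 (Set.mem_iInter.1 hθ n)).2 n le_rfl
  set q' : ℕ → ℍ := fun n => rotI θ • q n with hq'
  have hq'e : CoarseEmb L q' := hrot θ
  -- Past `n₀` the projection is more than `2 L` away from zero, so steps of at most `2 L` cannot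
  -- change its sign and the sequence follows one half of the axis.
  obtain ⟨n₀, hn₀⟩ := exists_nat_gt
    (L * (2 * Real.log (2 * R) + |axisProj (q' 0)| + 2 * L) + L)
  have hbig : ∀ n ≥ n₀, 2 * L < |axisProj (q' n)| := by
    intro n hn
    have h1 := hq'e.lower n 0
    rw [Nat.dist_eq, Nat.cast_zero, sub_zero, Nat.abs_cast] at h1
    have h2 := dist_triangle4 (q' n) (axisPt (axisProj (q' n))) (axisPt (axisProj (q' 0))) (q' 0)
    rw [dist_axisPt, dist_comm (axisPt _) (q' 0)] at h2
    have h3 := fun n => (dist_axisPt_axisProj_le (q' n)).trans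
      (Real.log_le_log (by linarith [axisRatio_pos (q' n)])
        (mul_le_mul_of_nonneg_left (hθR n) zero_le_two))
    have h4 := h3 n
    have h5 := h3 0
    have h6 := abs_sub (axisProj (q' n)) (axisProj (q' 0))
    have h7 : (n₀ : ℝ) ≤ n := by exact_mod_cast hn
    by_contra! h8
    have h9 : dist (q' n) (q' 0) ≤ 2 * Real.log (2 * R) + |axisProj (q' 0)| + 2 * L := by linarith
    have h10 := mul_le_mul_of_nonneg_left h9 hL0.le
    linarith
  have hstep : ∀ n, |axisProj (q' n) - axisProj (q' (n + 1))| ≤ 2 * L := fun n =>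
    (abs_axisProj_sub_le _ _).trans (hq'e.dist_succ_le n)
  have hsign : (∀ n ≥ n₀, 0 ≤ axisProj (q' n)) ∨ ∀ n ≥ n₀, axisProj (q' n) ≤ 0 := by
    rcases le_total 0 (axisProj (q' n₀)) with h0 | h0
    · left
      intro n hn
      induction n, hn using Nat.le_induction with
      | base => exact h0
      | succ n hn ih =>
        have h1 := hbig n hn
        rw [abs_of_nonneg ih] at h1
        linarith [(abs_le.1 (hstep n)).2]
    · right
      intro n hn
      induction n, hn using Nat.le_induction with
      | base => exact h0
      | succ n hn ih =>
        have h1 := hbig n hn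
        rw [abs_of_nonpos ih] at h1
        linarith [(abs_le.1 (hstep n)).1]
  rcases hsign with h | h
  · obtain ⟨C, hC⟩ := exists_near_positive_axis hθR h
    refine ⟨(rotI θ)⁻¹, C, fun n => ?_⟩
    obtain ⟨s, hs⟩ := hC n
    refine ⟨s, ?_⟩
    rwa [← SL_dist_smul (rotI θ), smul_inv_smul]
  · obtain ⟨C, hC⟩ := exists_near_positive_axis (q := fun n => rotI (Real.pi / 2) • q' n) (R := R)
      (n₀ := n₀) (fun n => by rw [(rotI_quarter_smul _).2]; exact hθR n)
      (fun n hn => by rw [axisProj_rotI_quarter_smul]; linarith [h n hn])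
    refine ⟨(rotI θ)⁻¹ * (rotI (Real.pi / 2))⁻¹, C, fun n => ?_⟩
    obtain ⟨s, hs⟩ := hC n
    refine ⟨s, ?_⟩
    rwa [← SL_dist_smul (rotI θ), mul_smul, smul_inv_smul, ← SL_dist_smul (rotI (Real.pi / 2)),
      smul_inv_smul]

/-- A quasi-geodesic ray is within bounded distance of a geodesic ray. -/
lemma exists_ray_near {L : ℝ} (hL : 1 ≤ L) {q : ℝ≥0 → ℍ} (hq : CoarseEmb L q) :
    ∃ (γ : SL(2, ℝ)) (C : ℝ), ∀ t, ∃ s : ℝ≥0, dist (q t) (γ • axisPt s) ≤ C := by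
  have hiso : Isometry fun n : ℕ => (n : ℝ≥0) := Isometry.of_dist_eq fun a b => by
    rw [NNReal.dist_eq, Nat.dist_eq]
    simp
  obtain ⟨γ, C, h⟩ := exists_ray_near_nat hL (hq.comp_isometry hiso)
  refine ⟨γ, 2 * L + C, fun t => ?_⟩
  obtain ⟨s, hs⟩ := h ⌊t⌋₊
  refine ⟨s, ?_⟩
  have h1 := hq.lip t (⌊t⌋₊ : ℝ≥0)
  have h2 : dist t (⌊t⌋₊ : ℝ≥0) ≤ 1 := by
    rw [NNReal.dist_eq, NNReal.coe_natCast]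
    have a1 : ((⌊t⌋₊ : ℝ≥0) : ℝ) ≤ t := NNReal.coe_le_coe.2 (Nat.floor_le zero_le)
    have a2 : (t : ℝ) < ((⌊t⌋₊ + 1 : ℝ≥0) : ℝ) := NNReal.coe_lt_coe.2 (Nat.lt_floor_add_one t)
    push_cast at a1 a2
    rw [abs_of_nonneg (by linarith)]
    linarith
  have h3 := dist_triangle (q t) (q (⌊t⌋₊ : ℝ≥0)) (γ • axisPt s)
  nlinarith

/-! ### Geodesic rays and their endpoints -/

/-- The endpoint of the image of the upper half of the imaginary axis under a Möbius
transformation. -/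
def rayEnd (γ : SL(2, ℝ)) : OnePoint ℝ :=
  open Classical in if γ 1 0 = 0 then OnePoint.infty else ((γ 0 0 / γ 1 0 : ℝ) : OnePoint ℝ)

lemma rayEnd_surjective (ξ : OnePoint ℝ) : ∃ γ, rayEnd γ = ξ := by
  induction ξ using OnePoint.rec with
  | infty => exact ⟨1, by simp [rayEnd]⟩
  | coe x =>
    refine ⟨⟨!![x, -1; 1, 0], by rw [Matrix.det_fin_two_of]; ring⟩, ?_⟩
    simp [rayEnd]

lemma SL_det_eq_one (γ : SL(2, ℝ)) : γ 0 0 * γ 1 1 - γ 0 1 * γ 1 0 = 1 := by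
  rw [← Matrix.det_fin_two, γ.det_coe]

/-- The endpoint is `γ ∞`, so `γ⁻¹ γ'` fixes `∞` and is upper triangular. -/
lemma inv_mul_apply_one_zero_of_rayEnd_eq {γ γ' : SL(2, ℝ)} (h : rayEnd γ = rayEnd γ') :
    (γ⁻¹ * γ') 1 0 = 0 := by
  have e : (γ⁻¹ * γ') 1 0 = - γ 1 0 * γ' 0 0 + γ 0 0 * γ' 1 0 := by
    rw [Matrix.SpecialLinearGroup.coe_mul, Matrix.SpecialLinearGroup.coe_inv,
      Matrix.adjugate_fin_two, Matrix.mul_apply, Fin.sum_univ_two]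
    simp
  rw [e]
  unfold rayEnd at h
  split_ifs at h with h1 h2 h2
  · rw [h1, h2]; ring
  · exact absurd h (OnePoint.infty_ne_coe _)
  · exact absurd h (OnePoint.coe_ne_infty _)
  · rw [OnePoint.coe_eq_coe, div_eq_div_iff h1 h2] at h
    linarith

lemma coe_smul_axisPt (γ : SL(2, ℝ)) (t : ℝ) : ((γ • axisPt t : ℍ) : ℂ)
    = (γ 0 0 * (axisPt t : ℂ) + γ 0 1) / (γ 1 0 * (axisPt t : ℂ) + γ 1 1) := by
  rw [UpperHalfPlane.coe_specialLinearGroup_apply]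
  rfl

/-- The standard ray is a geodesic ray with the expected endpoint. -/
lemma isGeodesicRayTo_smul_axisPt (γ : SL(2, ℝ)) :
    IsGeodesicRayTo (fun t : ℝ≥0 => γ • axisPt t) (rayEnd γ) := by
  refine ⟨Isometry.of_dist_eq fun a b => ?_, ?_⟩
  · rw [SL_dist_smul, dist_axisPt, NNReal.dist_eq]
  have hexp : Filter.Tendsto (fun t : ℝ≥0 => Real.exp t) Filter.atTop Filter.atTop :=
    Real.tendsto_exp_atTop.comp (NNReal.tendsto_coe_atTop.2 Filter.tendsto_id)
  by_cases hc : γ 1 0 = 0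
  · have hd : γ 1 1 ≠ 0 := by
      intro hd
      have := SL_det_eq_one γ
      rw [hc, hd] at this
      norm_num at this
    rw [rayEnd, if_pos hc, OnePoint.map_infty]
    refine OnePoint.tendsto_coe_infty.comp ?_
    rw [Filter.coclosedCompact_eq_cocompact, ← Metric.cobounded_eq_cocompact,
      ← tendsto_norm_atTop_iff_cobounded]
    have h1 : Filter.Tendsto (fun t : ℝ≥0 => Real.exp t / (γ 1 1) ^ 2) Filter.atTop
        Filter.atTop := hexp.atTop_div_const (by positivity)
    refine Filter.tendsto_atTop_mono (fun t => ?_) h1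
    have h2 := SL_im_smul γ (axisPt t)
    rw [hc, axisPt_im] at h2
    simp only [Complex.ofReal_zero, zero_mul, zero_add, Complex.norm_real, Real.norm_eq_abs,
      sq_abs] at h2
    rw [← h2]
    exact (le_abs_self _).trans (Complex.abs_im_le_norm _)
  · rw [rayEnd, if_neg hc, OnePoint.map_some]
    refine (OnePoint.continuous_coe.tendsto _).comp ?_
    rw [tendsto_iff_dist_tendsto_zero]
    have hc' : (γ 1 0 : ℂ) ≠ 0 := Complex.ofReal_ne_zero.2 hc
    have h1 : Filter.Tendsto (fun t : ℝ≥0 => 1 / (|γ 1 0| * |γ 1 0|) / Real.exp t) Filter.atTop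
        (nhds 0) := hexp.const_div_atTop _
    refine squeeze_zero (fun _ => dist_nonneg) (fun t => ?_) h1
    have hden := SL_denom_ne_zero γ (axisPt t)
    have e : ((γ • axisPt t : ℍ) : ℂ) - ((γ 0 0 / γ 1 0 : ℝ) : ℂ)
        = -1 / (γ 1 0 * (γ 1 0 * (axisPt t : ℂ) + γ 1 1)) := by
      have hdet : (γ 0 0 : ℂ) * γ 1 1 - γ 0 1 * γ 1 0 = 1 := by exact_mod_cast SL_det_eq_one γ
      rw [coe_smul_axisPt, Complex.ofReal_div, div_sub_div _ _ hden hc',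
        div_eq_div_iff (mul_ne_zero hden hc') (mul_ne_zero hc' hden)]
      linear_combination (-(γ 1 0 * (γ 1 0 * (axisPt t : ℂ) + γ 1 1)) : ℂ) * hdet
    rw [dist_eq_norm, e, norm_div, norm_neg, norm_one, norm_mul, Complex.norm_real,
      Real.norm_eq_abs, div_div]
    have hpos : 0 < |γ 1 0| := abs_pos.2 hc
    refine one_div_le_one_div_of_le (by positivity) ?_
    rw [mul_assoc]
    refine mul_le_mul_of_nonneg_left ?_ hpos.le
    have h3 : (γ 1 0 * (axisPt t : ℂ) + γ 1 1).im = γ 1 0 * Real.exp t := by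
      simp
    have h4 := Complex.abs_im_le_norm (γ 1 0 * (axisPt t : ℂ) + γ 1 1)
    rwa [h3, abs_mul, Real.abs_exp] at h4

/-- Near a real point the imaginary part tends to zero, and so does the Euclidean size of hyperbolic
balls of fixed radius. Finite endpoints are handled here; `∞` then follows by exclusion. -/
lemma tendsto_coe_of_dist_le {ι : Type*} {l : Filter ι} {z w : ι → ℍ} {C : ℝ}
    (h : ∀ i, dist (z i) (w i) ≤ C) {x : ℝ}
    (hz : Filter.Tendsto (fun i => ((z i : ℂ) : OnePoint ℂ)) l (nhds ((x : ℂ) : OnePoint ℂ))) :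
    Filter.Tendsto (fun i => ((w i : ℂ) : OnePoint ℂ)) l (nhds ((x : ℂ) : OnePoint ℂ)) := by
  have hz' : Filter.Tendsto (fun i => (z i : ℂ)) l (nhds (x : ℂ)) :=
    OnePoint.isOpenEmbedding_coe.tendsto_nhds_iff.2 hz
  refine (OnePoint.continuous_coe.tendsto _).comp ?_
  have him : Filter.Tendsto (fun i => (z i).im) l (nhds 0) := by
    have := (Complex.continuous_im.tendsto (x : ℂ)).comp hz'
    rwa [Complex.ofReal_im] at this
  refine hz'.congr_dist ?_
  have h1 : Filter.Tendsto (fun i => (z i).im * (Real.exp C - 1)) l (nhds 0) := by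
    simpa using him.mul_const (Real.exp C - 1)
  refine squeeze_zero (fun _ => dist_nonneg) (fun i => ?_) h1
  rw [dist_comm]
  refine (UpperHalfPlane.dist_coe_le (w i) (z i)).trans ?_
  have := Real.exp_le_exp.2 (h i)
  rw [dist_comm] at this
  exact mul_le_mul_of_nonneg_left (by linarith) (z i).im_pos.le

/-- Sequences at bounded distance converge to the same point of the boundary. -/
lemma boundary_limit_unique {ι : Type*} {l : Filter ι} [l.NeBot] {z w : ι → ℍ} {C : ℝ}
    (h : ∀ i, dist (z i) (w i) ≤ C) {ξ ξ' : OnePoint ℝ}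
    (hz : Filter.Tendsto (fun i => ((z i : ℂ) : OnePoint ℂ)) l
      (nhds (OnePoint.map (fun x : ℝ => (x : ℂ)) ξ)))
    (hw : Filter.Tendsto (fun i => ((w i : ℂ) : OnePoint ℂ)) l
      (nhds (OnePoint.map (fun x : ℝ => (x : ℂ)) ξ'))) : ξ = ξ' := by
  have aux : ∀ (z w : ι → ℍ), (∀ i, dist (z i) (w i) ≤ C) → ∀ (x : ℝ) (ξ' : OnePoint ℝ),
      Filter.Tendsto (fun i => ((z i : ℂ) : OnePoint ℂ)) l (nhds ((x : ℂ) : OnePoint ℂ)) →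
      Filter.Tendsto (fun i => ((w i : ℂ) : OnePoint ℂ)) l
        (nhds (OnePoint.map (fun x : ℝ => (x : ℂ)) ξ')) → (x : OnePoint ℝ) = ξ' := by
    intro z w h x ξ' hz hw
    have h1 := tendsto_nhds_unique (tendsto_coe_of_dist_le h hz) hw
    induction ξ' using OnePoint.rec with
    | infty => exact absurd h1 (OnePoint.coe_ne_infty _)
    | coe y =>
      rw [OnePoint.map_some, OnePoint.coe_eq_coe, Complex.ofReal_inj] at h1
      rw [h1]
  induction ξ using OnePoint.rec with
  | coe x => exact aux z w h x ξ' hz hw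
  | infty =>
    induction ξ' using OnePoint.rec with
    | infty => rfl
    | coe y => exact (aux w z (fun i => by rw [dist_comm]; exact h i) y _ hw hz).symm

/-- The endpoint of a geodesic ray near a quasi-geodesic ray is determined. -/
lemma endpoint_unique {L : ℝ} (hL : 1 ≤ L) {q : ℝ≥0 → ℍ} (hq : CoarseEmb L q)
    {γ₁ γ₂ : ℝ≥0 → ℍ} {ξ₁ ξ₂ : OnePoint ℝ} (h₁ : IsGeodesicRayTo γ₁ ξ₁)
    (h₂ : IsGeodesicRayTo γ₂ ξ₂) {C₁ C₂ : ℝ} (hC₁ : ∀ t, ∃ s, dist (q t) (γ₁ s) ≤ C₁)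
    (hC₂ : ∀ t, ∃ s, dist (q t) (γ₂ s) ≤ C₂) : ξ₁ = ξ₂ := by
  have hL0 : 0 < L := by linarith
  -- The quasi-geodesic leaves every bounded set, so the parameters of the nearby points on the ray
  -- tend to infinity.
  have key : ∀ (γ : ℝ≥0 → ℍ) (C : ℝ) (s : ℝ≥0 → ℝ≥0), Isometry γ →
      (∀ t, dist (q t) (γ (s t)) ≤ C) → Filter.Tendsto s Filter.atTop Filter.atTop := by
    intro γ C s hγ hs
    rw [← NNReal.tendsto_coe_atTop]
    have h1 : Filter.Tendsto (fun t : ℝ≥0 => ((t : ℝ) - L) / L - C - dist (q 0) (γ 0))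
        Filter.atTop Filter.atTop := by
      refine Filter.tendsto_atTop_add_const_right _ _ (Filter.tendsto_atTop_add_const_right _ _ ?_)
      refine Filter.Tendsto.atTop_div_const hL0 (Filter.tendsto_atTop_add_const_right _ _ ?_)
      exact NNReal.tendsto_coe_atTop.2 Filter.tendsto_id
    refine Filter.tendsto_atTop_mono (fun t => ?_) h1
    have h2 := hq.lower t 0
    rw [NNReal.dist_eq, NNReal.coe_zero, sub_zero, NNReal.abs_eq] at h2
    have h3 := dist_triangle4 (q t) (γ (s t)) (γ 0) (q 0)
    rw [hγ.dist_eq, NNReal.dist_eq, NNReal.coe_zero, sub_zero, NNReal.abs_eq,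
      dist_comm (γ 0)] at h3
    have h4 : ((t : ℝ) - L) / L ≤ dist (q t) (q 0) := by
      rw [div_le_iff₀ hL0]
      linarith
    linarith [hs t]
  choose s₁ hs₁ using hC₁
  choose s₂ hs₂ using hC₂
  refine boundary_limit_unique (l := (Filter.atTop : Filter ℝ≥0)) (z := fun t => γ₁ (s₁ t))
    (w := fun t => γ₂ (s₂ t)) (C := C₁ + C₂) (fun t => ?_) (h₁.2.comp (key _ _ _ h₁.1 hs₁))
    (h₂.2.comp (key _ _ _ h₂.1 hs₂))
  have h1 := dist_triangle_left (γ₁ (s₁ t)) (γ₂ (s₂ t)) (q t)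
  linarith [hs₁ t, hs₂ t]

/-- The image is a half of a vertical line, and `exp s ≥ 1` keeps its ratio to the axis bounded. Its
projection starts at or above `log |a / d|`, so replacing negative parameters by `0` costs at most
`|l|`. -/
lemma exists_near_axis_of_upper_triangular (γ : SL(2, ℝ)) (h : γ 1 0 = 0) :
    ∃ C, ∀ s : ℝ≥0, ∃ s' : ℝ≥0, dist (γ • axisPt s) (axisPt s') ≤ C := by
  have hdet := SL_det_eq_one γ
  rw [h, mul_zero, sub_zero] at hdet
  have ha : 0 < |γ 0 0| := abs_pos.2 fun h0 => by rw [h0, zero_mul] at hdet; norm_num at hdet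
  have hd : 0 < |γ 1 1| := abs_pos.2 fun h0 => by rw [h0, mul_zero] at hdet; norm_num at hdet
  set K := (|γ 0 0| + |γ 0 1|) * |γ 1 1| with hK
  set l := Real.log (|γ 0 0| / |γ 1 1|) with hl
  refine ⟨Real.log (2 * K) + |l|, fun s => ?_⟩
  have hs1 : 1 ≤ Real.exp (s : ℝ) := Real.one_le_exp s.coe_nonneg
  have hden : ‖(γ 1 0 * (axisPt s : ℂ) + γ 1 1 : ℂ)‖ = |γ 1 1| := by
    rw [h]
    simp
  have hr : axisRatio (γ • axisPt s) ≤ K := by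
    rw [axisRatio_smul, hden, axisPt_im, div_le_iff₀ (Real.exp_pos _), hK]
    have h1 : ‖(γ 0 0 * (axisPt s : ℂ) + γ 0 1 : ℂ)‖ ≤ |γ 0 0| * Real.exp s + |γ 0 1| := by
      refine (norm_add_le _ _).trans ?_
      rw [norm_mul, norm_axisPt, Complex.norm_real, Complex.norm_real, Real.norm_eq_abs,
        Real.norm_eq_abs]
    have h2 := mul_le_mul_of_nonneg_right h1 hd.le
    nlinarith [mul_nonneg (mul_nonneg (abs_nonneg (γ 0 1)) hd.le) (sub_nonneg.2 hs1)]
  have hp : l ≤ axisProj (γ • axisPt s) := by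
    rw [axisProj, SL_norm_smul, hden, hl]
    refine Real.log_le_log (by positivity) (div_le_div_of_nonneg_right ?_ hd.le)
    have h1 : (γ 0 0 * (axisPt s : ℂ) + γ 0 1).im = γ 0 0 * Real.exp s := by simp
    have h2 := Complex.abs_im_le_norm (γ 0 0 * (axisPt s : ℂ) + γ 0 1)
    rw [h1, abs_mul, Real.abs_exp] at h2
    nlinarith
  refine ⟨NNReal.mk (max (axisProj (γ • axisPt s)) 0) (le_max_right _ _), ?_⟩
  have h1 := dist_axisPt_axisProj_le (γ • axisPt s)
  have h2 := Real.log_le_log (by linarith [axisRatio_pos (γ • axisPt s)])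
    (mul_le_mul_of_nonneg_left hr zero_le_two)
  have h3 := dist_triangle (γ • axisPt s) (axisPt (axisProj (γ • axisPt s)))
    (axisPt (max (axisProj (γ • axisPt s)) 0))
  rw [dist_axisPt] at h3
  have h4 : |axisProj (γ • axisPt s) - max (axisProj (γ • axisPt s)) 0| ≤ |l| := by
    rcases le_total 0 (axisProj (γ • axisPt s)) with h0 | h0
    · rw [max_eq_left h0, sub_self, abs_zero]
      exact abs_nonneg _
    · rw [max_eq_right h0, sub_zero, abs_of_nonpos h0, abs_of_nonpos (hp.trans h0)]
      linarith
  exact h3.trans (by linarith)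

lemma exists_near_smul_axisPt_of_rayEnd_eq {γ γ' : SL(2, ℝ)} (h : rayEnd γ = rayEnd γ') :
    ∃ C, ∀ s : ℝ≥0, ∃ s' : ℝ≥0, dist (γ' • axisPt s) (γ • axisPt s') ≤ C := by
  obtain ⟨C, hC⟩ := exists_near_axis_of_upper_triangular _ (inv_mul_apply_one_zero_of_rayEnd_eq h)
  refine ⟨C, fun s => ?_⟩
  obtain ⟨s', hs'⟩ := hC s
  refine ⟨s', ?_⟩
  rwa [← SL_dist_smul γ, mul_smul, smul_inv_smul] at hs'

/-- Geodesic rays with the same endpoint are at bounded distance. -/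
lemma IsGeodesicRayTo.exists_near {q : ℝ≥0 → ℍ} {ξ : OnePoint ℝ} (hq : IsGeodesicRayTo q ξ)
    {γ : SL(2, ℝ)} (hγ : rayEnd γ = ξ) :
    ∃ C, ∀ t, ∃ s : ℝ≥0, dist (q t) (γ • axisPt s) ≤ C := by
  have hemb := coarseEmb_isometry hq.1
  obtain ⟨γ', C, hC⟩ := exists_ray_near le_rfl hemb
  have h1 : ξ = rayEnd γ' := endpoint_unique le_rfl hemb hq (isGeodesicRayTo_smul_axisPt γ')
    (C₁ := 0) (fun t => ⟨t, (dist_self _).le⟩) hC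
  obtain ⟨C', hC'⟩ := exists_near_smul_axisPt_of_rayEnd_eq (hγ.trans h1)
  refine ⟨C + C', fun t => ?_⟩
  obtain ⟨s, hs⟩ := hC t
  obtain ⟨s', hs'⟩ := hC' s
  exact ⟨s', (dist_triangle _ _ _).trans (add_le_add hs hs')⟩

/-! ### Boundary values of quasi-isometries of the plane -/

lemma isBoundaryMap_id : IsBoundaryMap id id := fun _ γ hγ =>
  ⟨γ, hγ, 0, fun t => ⟨t, (dist_self _).le⟩⟩

lemma IsBoundaryMap.congr {f f' : ℍ → ℍ} {F : OnePoint ℝ → OnePoint ℝ} (hf : IsBoundaryMap f F)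
    {D : ℝ} (h : ∀ z, dist (f' z) (f z) ≤ D) : IsBoundaryMap f' F := by
  intro ξ γ hγ
  obtain ⟨γ', hγ', C, hC⟩ := hf ξ γ hγ
  refine ⟨γ', hγ', D + C, fun t => ?_⟩
  obtain ⟨s, hs⟩ := hC t
  exact ⟨s, (dist_triangle _ _ _).trans (add_le_add (h _) hs)⟩

lemma IsBoundaryMap.comp {f g : ℍ → ℍ} {F G : OnePoint ℝ → OnePoint ℝ} {L : ℝ} (hL : 1 ≤ L)
    (hlip : CoarseLip L f) (hf : IsBoundaryMap f F) (hg : IsBoundaryMap g G) :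
    IsBoundaryMap (f ∘ g) (F ∘ G) := by
  intro ξ γ hγ
  obtain ⟨γ', hγ', C, hC⟩ := hg ξ γ hγ
  obtain ⟨γ'', hγ'', C', hC'⟩ := hf _ γ' hγ'
  refine ⟨γ'', hγ'', L * C + L + C', fun t => ?_⟩
  obtain ⟨s, hs⟩ := hC t
  obtain ⟨s', hs'⟩ := hC' s
  have h1 := hlip (g (γ t)) (γ' s)
  have h2 := mul_le_mul_of_nonneg_left hs (by linarith : 0 ≤ L)
  exact ⟨s', (dist_triangle (f (g (γ t))) (f (γ' s)) _).trans (by linarith)⟩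

lemma IsBoundaryMap.unique {f : ℍ → ℍ} {F F' : OnePoint ℝ → OnePoint ℝ} {L : ℝ} (hL : 1 ≤ L)
    (hemb : CoarseEmb L f) (hF : IsBoundaryMap f F) (hF' : IsBoundaryMap f F') : F = F' := by
  funext ξ
  obtain ⟨γ, hγ⟩ := rayEnd_surjective ξ
  have hray := isGeodesicRayTo_smul_axisPt γ
  rw [hγ] at hray
  obtain ⟨γ₁, h₁, C₁, hC₁⟩ := hF ξ _ hray
  obtain ⟨γ₂, h₂, C₂, hC₂⟩ := hF' ξ _ hray
  exact endpoint_unique hL (hemb.comp_isometry hray.1) h₁ h₂ hC₁ hC₂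

/-- One standard ray per boundary point determines the value; any other ray to that point
fellow-travels it, and `f` keeps the distance bounded. -/
lemma exists_isBoundaryMap {f : ℍ → ℍ} {L : ℝ} (hL : 1 ≤ L) (hemb : CoarseEmb L f) :
    ∃ F, IsBoundaryMap f F := by
  choose M hM using rayEnd_surjective
  have h1 : ∀ ξ, ∃ (γ : SL(2, ℝ)) (C : ℝ), ∀ t : ℝ≥0, ∃ s : ℝ≥0,
      dist (f (M ξ • axisPt t)) (γ • axisPt s) ≤ C := fun ξ =>
    exists_ray_near hL (hemb.comp_isometry (isGeodesicRayTo_smul_axisPt (M ξ)).1)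
  choose N C hC using h1
  refine ⟨fun ξ => rayEnd (N ξ), fun ξ γ hγ => ?_⟩
  refine ⟨_, isGeodesicRayTo_smul_axisPt (N ξ), ?_⟩
  obtain ⟨C', hC'⟩ := hγ.exists_near (hM ξ)
  refine ⟨L * C' + L + C ξ, fun t => ?_⟩
  obtain ⟨s, hs⟩ := hC' t
  obtain ⟨s', hs'⟩ := hC ξ s
  have h1 := hemb.lip (γ t) (M ξ • axisPt s)
  have h2 := mul_le_mul_of_nonneg_left hs (by linarith : 0 ≤ L)
  exact ⟨s', (dist_triangle _ (f (M ξ • axisPt s)) _).trans (by linarith)⟩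

/-- If the boundary values are trivial, geodesic lines are mapped close to themselves. -/
lemma IsBoundaryMap.exists_axisRatio_le {f : ℍ → ℍ} (hf : IsBoundaryMap f id) (γ : SL(2, ℝ)) :
    ∃ C, ∀ t : ℝ, axisRatio (γ⁻¹ • f (γ • axisPt t)) ≤ C := by
  have key : ∀ γ : SL(2, ℝ), ∃ C, ∀ t : ℝ≥0, axisRatio (γ⁻¹ • f (γ • axisPt t)) ≤ C := by
    intro γ
    obtain ⟨γ', hγ', C, hC⟩ := hf _ _ (isGeodesicRayTo_smul_axisPt γ)
    obtain ⟨C', hC'⟩ := hγ'.exists_near (γ := γ) rfl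
    refine ⟨Real.exp (C + C'), fun t => ?_⟩
    obtain ⟨s, hs⟩ := hC t
    obtain ⟨s', hs'⟩ := hC' s
    refine (axisRatio_le_exp _ s').trans (Real.exp_le_exp.2 ?_)
    rw [← SL_dist_smul γ, smul_inv_smul]
    exact (dist_triangle _ _ _).trans (add_le_add hs hs')
  obtain ⟨C₁, h₁⟩ := key γ
  -- The half turn makes the negative half of the line a ray as well.
  obtain ⟨C₂, h₂⟩ := key (γ * rotI (Real.pi / 2))
  refine ⟨max C₁ C₂, fun t => ?_⟩
  rcases le_total 0 t with ht | ht
  · exact (h₁ ⟨t, ht⟩).trans (le_max_left _ _)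
  · refine le_trans ?_ (le_max_right _ _)
    have h := h₂ ⟨-t, by linarith⟩
    change axisRatio ((γ * rotI (Real.pi / 2))⁻¹ • f ((γ * rotI (Real.pi / 2)) • axisPt (-t)))
      ≤ C₂ at h
    rw [mul_smul, rotI_quarter_smul_axisPt, neg_neg, mul_inv_rev, mul_smul] at h
    rwa [← (rotI_quarter_smul _).2, smul_inv_smul] at h

/-- Quasi-isometries of the plane with trivial boundary values are uniformly close to the
identity. -/
theorem exists_dist_le_of_isBoundaryMap_id {L : ℝ} (hL : 1 ≤ L) :
    ∃ D, ∀ f : ℍ → ℍ, CoarseEmb L f → IsBoundaryMap f id → ∀ z, dist (f z) z ≤ D := by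
  obtain ⟨R, hR⟩ := exists_axisRatio_le_of_line hL
  refine ⟨Real.log (4 * R), fun f hemb hf z => ?_⟩
  -- The boundary values give only some bound `C` depending on `f` and the line; stability of
  -- quasi-geodesic lines replaces it by the uniform `R`.
  have key : ∀ γ : SL(2, ℝ), γ • UpperHalfPlane.I = z → axisRatio (γ⁻¹ • f z) ≤ R := by
    intro γ hγ
    obtain ⟨C, hC⟩ := hf.exists_axisRatio_le γ
    have hiso : Isometry fun n : ℤ => γ • axisPt n := Isometry.of_dist_eq fun a b => by
      rw [SL_dist_smul, dist_axisPt, Int.dist_eq]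
    have h := hR (fun n => γ⁻¹ • f (γ • axisPt n))
      ((hemb.comp_isometry hiso).isometry_comp (isometry_smul ℍ γ⁻¹)) ⟨C, fun n => hC n⟩ 0
    simpa [hγ] using h
  obtain ⟨γ, hγ⟩ := exists_SL_smul_I z
  have h1 := key γ hγ
  have h2 := key (γ * (rotI (Real.pi / 4))⁻¹) (by
    rw [mul_smul, inv_smul_eq_iff.2 (rotI_smul_I _).symm, hγ])
  rw [mul_inv_rev, inv_inv, mul_smul] at h2
  have h3 := dist_I_le_of_axisRatio_le h1 h2
  rwa [← SL_dist_smul γ, smul_inv_smul, hγ] at h3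

/-! ### Isometries with trivial boundary values. -/

/-- In the hyperboloid model, the sum of two points is a multiple of their midpoint. -/
lemma re_div_im_midpoint {z w m : ℍ} {r : ℝ} (hz : dist z m = r) (hw : dist m w = r)
    (hzw : dist z w = 2 * r) :
    z.re / z.im + w.re / w.im = 2 * Real.cosh r * (m.re / m.im) := by
  have key : ∀ z w : ℍ, 2 * Real.cosh (dist z w)
      = (‖(z : ℂ)‖ ^ 2 / z.im) * (1 / w.im) + (1 / z.im) * (‖(w : ℂ)‖ ^ 2 / w.im)
        - 2 * (z.re / z.im) * (w.re / w.im) := by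
    intro z w
    have h1 := z.im_ne_zero
    have h2 := w.im_ne_zero
    rw [cosh_dist_eq]
    field_simp
  have nrm : ∀ z : ℍ, (1 / z.im) * (‖(z : ℂ)‖ ^ 2 / z.im) - (z.re / z.im) ^ 2 = 1 := by
    intro z
    have h1 := z.im_ne_zero
    rw [UpperHalfPlane.norm_sq_eq]
    field_simp
    ring
  have e1 := key z m
  have e2 := key m w
  have e3 := key z w
  rw [hz] at e1
  rw [hw] at e2
  rw [hzw, Real.cosh_two_mul, Real.sinh_sq] at e3
  have n1 := nrm z
  have n2 := nrm w
  have n3 := nrm m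
  set c := Real.cosh r
  set a := 1 / z.im
  set a' := 1 / w.im
  set a'' := 1 / m.im
  set b := ‖(z : ℂ)‖ ^ 2 / z.im
  set b' := ‖(w : ℂ)‖ ^ 2 / w.im
  set b'' := ‖(m : ℂ)‖ ^ 2 / m.im
  set x := z.re / z.im
  set x' := w.re / w.im
  set x'' := m.re / m.im
  -- `(P, S, Q)` is the difference vector for the Lorentz form `P S - Q²`. It is null (`f1`) and
  -- orthogonal to the timelike vector of `m` (`f2`), which forces `Q = 0`.
  set P := a + a' - 2 * c * a'' with hP
  set Q := x + x' - 2 * c * x'' with hQ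
  set S := b + b' - 2 * c * b'' with hS
  have f1 : P * S = Q ^ 2 := by
    rw [hP, hS, hQ]
    linear_combination n1 + n2 + 4 * c ^ 2 * n3 - e3 + 2 * c * e1 + 2 * c * e2
  have f2 : P * b'' + S * a'' = 2 * Q * x'' := by
    rw [hP, hS, hQ]
    linear_combination -e1 - e2 - 4 * c * n3
  have f3 : (P * b'' - S * a'') ^ 2 = -4 * Q ^ 2 := by
    linear_combination (P * b'' + S * a'' + 2 * Q * x'') * f2 - 4 * (a'' * b'') * f1
      - 4 * Q ^ 2 * n3
  have f4 : Q = 0 := by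
    have := sq_nonneg (P * b'' - S * a'')
    have h0 : Q ^ 2 ≤ 0 := by linarith
    exact pow_eq_zero_iff two_ne_zero |>.1 (le_antisymm h0 (sq_nonneg Q))
  rw [hQ] at f4
  linarith

lemma abs_re_div_im_le (z : ℍ) : |z.re / z.im| ≤ axisRatio z := by
  rw [abs_div, abs_of_pos z.im_pos, axisRatio]
  exact div_le_div_of_nonneg_right (Complex.abs_re_le_norm _) z.im_pos.le

/-- An isometry of the plane with trivial boundary values is the identity. -/
theorem isometry_eq_of_isBoundaryMap_id {f : ℍ → ℍ} (hiso : Isometry f)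
    (hf : IsBoundaryMap f id) (z : ℍ) : f z = z := by
  have key : ∀ γ : SL(2, ℝ), γ • UpperHalfPlane.I = z → (γ⁻¹ • f z : ℍ).re = 0 := by
    intro γ hγ
    obtain ⟨C, hC⟩ := hf.exists_axisRatio_le γ
    set q : ℝ → ℍ := fun t => γ⁻¹ • f (γ • axisPt t) with hq
    have hqd : ∀ s t, dist (q s) (q t) = |s - t| := fun s t => by
      rw [hq, SL_dist_smul, hiso.dist_eq, SL_dist_smul, dist_axisPt]
    -- The quotient `re / im` is bounded along the image line, while the midpoint formula multiplies
    -- its value at the midpoint by `cosh r`. Letting `r` grow forces that value to vanish.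
    have h1 : ∀ r : ℝ, 0 ≤ r → 2 * Real.cosh r * |(q 0).re / (q 0).im| ≤ 2 * C := by
      intro r hr
      have e := re_div_im_midpoint (z := q r) (w := q (-r)) (m := q 0) (r := r)
        (by rw [hqd, sub_zero, abs_of_nonneg hr])
        (by rw [hqd, zero_sub, neg_neg, abs_of_nonneg hr])
        (by rw [hqd, abs_of_nonneg (by linarith)]; ring)
      have h2 := abs_add_le ((q r).re / (q r).im) ((q (-r)).re / (q (-r)).im)
      have h3 := (abs_re_div_im_le (q r)).trans (hC r)
      have h4 := (abs_re_div_im_le (q (-r))).trans (hC (-r))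
      rw [e, abs_mul, abs_of_pos (by positivity)] at h2
      linarith
    have h0 : q 0 = γ⁻¹ • f z := by rw [hq]; simp [hγ]
    rw [← h0]
    by_contra hne
    have hx : 0 < |(q 0).re / (q 0).im| := abs_pos.2 (div_ne_zero hne (q 0).im_ne_zero)
    set x := |(q 0).re / (q 0).im| with hx'
    have hC0 : 0 ≤ C := zero_le_one.trans ((one_le_axisRatio _).trans (hC 0))
    have h5 := h1 (2 * C / x) (by positivity)
    have h6 := exp_le_two_mul_cosh (2 * C / x)
    have h7 := Real.add_one_le_exp (2 * C / x)
    have h8 : (2 * C / x + 1) * x ≤ 2 * C := by nlinarith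
    rw [add_mul, div_mul_cancel₀ _ hx.ne'] at h8
    linarith
  obtain ⟨γ, hγ⟩ := exists_SL_smul_I z
  have h1 := key γ hγ
  have h2 := key (γ * (rotI (Real.pi / 4))⁻¹) (by
    rw [mul_smul, inv_smul_eq_iff.2 (rotI_smul_I _).symm, hγ])
  rw [mul_inv_rev, inv_inv, mul_smul] at h2
  set w := γ⁻¹ • f z with hw
  have hden : (-Real.sin (Real.pi / 4) * (w : ℂ) + Real.cos (Real.pi / 4) : ℂ) ≠ 0 := by
    simpa [rotI] using SL_denom_ne_zero (rotI (Real.pi / 4)) w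
  have hden' : ‖(-Real.sin (Real.pi / 4) * (w : ℂ) + Real.cos (Real.pi / 4) : ℂ)‖ ^ 2 ≠ 0 :=
    pow_ne_zero 2 (norm_ne_zero_iff.2 hden)
  rw [re_rotI_smul, div_eq_zero_iff, or_iff_left hden', Real.cos_pi_div_four,
    Real.sin_pi_div_four, sub_self, zero_mul, zero_add, mul_eq_zero] at h2
  have h3 : ‖(w : ℂ)‖ ^ 2 = 1 := by
    rcases h2 with h2 | h2
    · have : (0 : ℝ) < √2 / 2 * (√2 / 2) := by positivity
      exact absurd h2 this.ne'
    · linarith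
  have h4 : w = UpperHalfPlane.I := by
    apply UpperHalfPlane.eq_of_re_of_norm
    · rw [h1, UpperHalfPlane.I_re]
    · rw [UpperHalfPlane.coe_I, Complex.norm_I]
      exact (sq_eq_sq₀ (norm_nonneg _) zero_le_one).1 (by rw [h3, one_pow])
  rw [hw, inv_smul_eq_iff, hγ] at h4
  exact h4

/-! ### Word metrics -/

section WordMetric

variable {G : Type*} [Group G] {S : Finset G}

lemma IsSymmGeneratingSet.exists_list (hS : IsSymmGeneratingSet S) (g h : G) :
    ∃ l : List G, (∀ a ∈ l, a ∈ S) ∧ g * l.prod = h := by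
  have hmem : g⁻¹ * h ∈ Submonoid.closure ((S : Set G) ∪ (S : Set G)⁻¹) := by
    rw [← Subgroup.closure_toSubmonoid, hS.2]
    trivial
  obtain ⟨l, hl, hprod⟩ := Submonoid.exists_list_of_mem_closure hmem
  refine ⟨l, fun a ha => ?_, by rw [hprod, mul_inv_cancel_left]⟩
  rcases hl a ha with h1 | h1
  · exact h1
  · have := hS.1 _ h1
    rwa [inv_inv] at this

lemma IsSymmGeneratingSet.exists_list_length_eq (hS : IsSymmGeneratingSet S) (g h : G) :
    ∃ l : List G, (∀ a ∈ l, a ∈ S) ∧ g * l.prod = h ∧ (l.length : ℝ) = wordDist S g h := by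
  obtain ⟨l, hl, hprod⟩ := hS.exists_list g h
  have hne : {n : ℕ | ∃ l : List G, l.length = n ∧ (∀ a ∈ l, a ∈ S) ∧ g * l.prod = h}.Nonempty :=
    ⟨l.length, l, rfl, hl, hprod⟩
  obtain ⟨l', h1, h2, h3⟩ := Nat.sInf_mem hne
  exact ⟨l', h2, h3, by rw [wordDist, h1]⟩

lemma wordDist_le_length (g : G) {l : List G} (hl : ∀ a ∈ l, a ∈ S) :
    wordDist S g (g * l.prod) ≤ l.length := by
  rw [wordDist]
  have : l.length ∈ {n : ℕ | ∃ l' : List G, l'.length = n ∧ (∀ a ∈ l', a ∈ S) ∧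
      g * l'.prod = g * l.prod} := ⟨l, rfl, hl, rfl⟩
  exact_mod_cast Nat.sInf_le this

lemma wordDist_nonneg (g h : G) : 0 ≤ wordDist S g h := Nat.cast_nonneg _

lemma wordDist_self (g : G) : wordDist S g g = 0 := by
  have := wordDist_le_length (S := S) g (l := []) (by simp)
  rw [List.prod_nil, mul_one, List.length_nil, Nat.cast_zero] at this
  exact le_antisymm this (wordDist_nonneg g g)

lemma wordDist_mul_left (x g h : G) : wordDist S (x * g) (x * h) = wordDist S g h := by
  simp only [wordDist, mul_assoc, mul_right_inj]

lemma IsSymmGeneratingSet.wordDist_triangle (hS : IsSymmGeneratingSet S) (g h k : G) :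
    wordDist S g k ≤ wordDist S g h + wordDist S h k := by
  obtain ⟨l, h1, h2, h3⟩ := hS.exists_list_length_eq g h
  obtain ⟨l', h1', h2', h3'⟩ := hS.exists_list_length_eq h k
  have := wordDist_le_length g (l := l ++ l') (fun a ha => by
    rcases List.mem_append.1 ha with h | h
    · exact h1 a h
    · exact h1' a h)
  rw [List.prod_append, ← mul_assoc, h2, h2', List.length_append, Nat.cast_add, h3, h3'] at this
  exact this

lemma IsSymmGeneratingSet.wordDist_comm (hS : IsSymmGeneratingSet S) (g h : G) :
    wordDist S g h = wordDist S h g := by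
  have key : ∀ g h, wordDist S h g ≤ wordDist S g h := by
    intro g h
    obtain ⟨l, h1, h2, h3⟩ := hS.exists_list_length_eq g h
    have := wordDist_le_length (S := S) h (l := (l.map fun a => a⁻¹).reverse) (fun a ha => by
      rw [List.mem_reverse, List.mem_map] at ha
      obtain ⟨b, hb, rfl⟩ := ha
      exact hS.1 b (h1 b hb))
    rw [← List.prod_inv_reverse, ← h2, mul_inv_cancel_right, List.length_reverse, List.length_map,
      h3, h2] at this
    exact this
  exact le_antisymm (key _ _) (key _ _)

lemma IsSymmGeneratingSet.abs_sub_le_mul_wordDist (hS : IsSymmGeneratingSet S) {f : G → ℝ} {C : ℝ}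
    (hf : ∀ g, ∀ a ∈ S, |f (g * a) - f g| ≤ C) (g h : G) : |f h - f g| ≤ C * wordDist S g h := by
  obtain ⟨l, h1, h2, h3⟩ := hS.exists_list_length_eq g h
  rw [← h3]
  subst h2
  clear h3
  induction l generalizing g with
  | nil => simp
  | cons a l ih =>
    have e1 := ih (g * a) fun b hb => h1 b (List.mem_cons_of_mem _ hb)
    have e2 := hf g a (h1 a List.mem_cons_self)
    rw [List.prod_cons, ← mul_assoc, List.length_cons]
    have e3 := abs_sub_le (f (g * a * l.prod)) (f (g * a)) (f g)
    push_cast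
    linarith

lemma IsSymmGeneratingSet.finite_ball (hS : IsSymmGeneratingSet S) (g : G) (r : ℝ) :
    {h | wordDist S g h ≤ r}.Finite := by
  have hfin := (List.finite_length_le S ⌈r⌉₊).image fun l => g * (l.map Subtype.val).prod
  refine hfin.subset fun h hh => ?_
  obtain ⟨l, h1, h2, h3⟩ := hS.exists_list_length_eq g h
  lift l to List S using h1
  refine ⟨l, ?_, h2⟩
  have h4 : wordDist S g h ≤ r := hh
  rw [← h3, List.length_map] at h4
  have h5 : (l.length : ℝ) ≤ ⌈r⌉₊ := h4.trans (Nat.le_ceil r)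
  exact_mod_cast h5

lemma IsSymmGeneratingSet.wordDist_one_mul_le (hS : IsSymmGeneratingSet S) (g h : G) :
    wordDist S 1 (g * h) ≤ wordDist S 1 g + wordDist S 1 h := by
  have h1 := hS.wordDist_triangle 1 g (g * h)
  have h2 := wordDist_mul_left (S := S) g 1 h
  rw [mul_one] at h2
  rwa [h2] at h1

lemma IsSymmGeneratingSet.wordDist_one_pow_le (hS : IsSymmGeneratingSet S) (g : G) (n : ℕ) :
    wordDist S 1 (g ^ n) ≤ n * wordDist S 1 g := by
  induction n with
  | zero => simp [wordDist_self]
  | succ n ih =>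
    rw [pow_succ]
    refine (hS.wordDist_one_mul_le _ _).trans ?_
    push_cast
    linarith

lemma IsSymmGeneratingSet.wordDist_one_zpow_le (hS : IsSymmGeneratingSet S) (g : G) (n : ℤ) :
    wordDist S 1 (g ^ n) ≤ |(n : ℝ)| * wordDist S 1 g := by
  have e : (|(n : ℝ)|) = n.natAbs := by rw [Nat.cast_natAbs, Int.cast_abs]
  rw [e]
  have h0 := hS.wordDist_one_pow_le g n.natAbs
  rcases Int.natAbs_eq n with h | h
  · rw [h, zpow_natCast, Int.natAbs_natCast]
    exact h0
  · rw [h, zpow_neg, zpow_natCast, Int.natAbs_neg, Int.natAbs_natCast]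
    have h1 := wordDist_mul_left (S := S) (g ^ n.natAbs) 1 (g ^ n.natAbs)⁻¹
    rw [mul_one, mul_inv_cancel, hS.wordDist_comm] at h1
    rw [← h1]
    exact h0

end WordMetric

/-- A coarse isometry with coarsely dense image gives a quasi-isometry to the line. -/
lemma quasiIsometric_real_of_coarse {X : Type*} (d : X → X → ℝ) (f : X → ℝ) (A : ℝ) (hA : 1 ≤ A)
    (hupper : ∀ x y, |f x - f y| ≤ A * d x y) (hlower : ∀ x y, d x y ≤ A * |f x - f y| + A)
    (hdense : ∀ y, ∃ x, |y - f x| ≤ A) :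
    QuasiIsometric d (fun s t : ℝ => dist s t) := by
  choose w hw using hdense
  have hA0 : 0 < A := by linarith
  have hww : ∀ s t, |f (w s) - f (w t)| ≤ |s - t| + 2 * A := by
    intro s t
    have h1 := abs_sub_le (f (w s)) s (f (w t))
    have h2 := abs_sub_le s t (f (w t))
    rw [abs_sub_comm (f (w s)) s] at h1
    linarith [hw s, hw t]
  have hww' : ∀ s t, |s - t| ≤ |f (w s) - f (w t)| + 2 * A := by
    intro s t
    have h1 := abs_sub_le s (f (w s)) t
    have h2 := abs_sub_le (f (w s)) (f (w t)) t
    rw [abs_sub_comm (f (w t)) t] at h2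
    linarith [hw s, hw t]
  refine ⟨A, 2 * A ^ 2 + A + 2, 2 * A ^ 2 + A + 2, f, w, ⟨hA, by positivity, ?_, ?_, ?_⟩,
    ⟨hA, by positivity, ?_, ?_, ?_⟩, 2 * A ^ 2 + A + 2, ?_, ?_⟩
  · intro x y
    have h1 : 1 / A * d x y ≤ |f x - f y| + 1 := by
      rw [one_div_mul_eq_div, div_le_iff₀ hA0]
      linarith [hlower x y]
    rw [Real.dist_eq]
    nlinarith
  · intro x y
    rw [Real.dist_eq]
    nlinarith [hupper x y]
  · intro y
    refine ⟨w y, ?_⟩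
    rw [Real.dist_eq]
    nlinarith [hw y]
  · intro s t
    have h1 : 1 / A * dist s t ≤ d (w s) (w t) + 2 := by
      rw [one_div_mul_eq_div, div_le_iff₀ hA0, Real.dist_eq]
      linarith [hww' s t, hupper (w s) (w t)]
    nlinarith
  · intro s t
    rw [Real.dist_eq]
    have h1 := hlower (w s) (w t)
    have h2 := mul_le_mul_of_nonneg_left (hww s t) hA0.le
    nlinarith
  · intro x
    refine ⟨f x, ?_⟩
    have h1 := hlower x (w (f x))
    have h2 := mul_le_mul_of_nonneg_left (hw (f x)) hA0.le
    nlinarith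
  · intro x
    have h1 := hlower x (w (f x))
    have h2 := mul_le_mul_of_nonneg_left (hw (f x)) hA0.le
    nlinarith
  · intro y
    rw [Real.dist_eq]
    nlinarith [hw y]

/-! ### Groups quasi-acting on the line -/

/-- `φ` is a quasi-action of the group `G`, by uniform quasi-isometries. -/
structure IsQuasiAction {G X : Type*} [Group G] [MetricSpace X] (L : ℝ) (φ : G → X → X) :
    Prop where
  one_le : 1 ≤ L
  lip : ∀ u, CoarseLip L (φ u)
  mul : ∀ u v x, dist (φ u (φ v x)) (φ (u * v) x) ≤ L
  one : ∀ x, dist (φ 1 x) x ≤ L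

namespace IsQuasiAction

lemma coarseInverses {G X : Type*} [Group G] [MetricSpace X] {L : ℝ} {φ : G → X → X}
    (h : IsQuasiAction L φ) (u : G) : CoarseInverses (2 * L) (φ u) (φ u⁻¹) := by
  have hL := h.one_le
  have hlip : ∀ u, CoarseLip (2 * L) (φ u) := by
    intro u x y
    have h1 := h.lip u x y
    have h2 : 0 ≤ dist x y := dist_nonneg
    nlinarith
  have hinv : ∀ u x, dist (φ u⁻¹ (φ u x)) x ≤ 2 * L := by
    intro u x
    have h1 := h.mul u⁻¹ u x
    rw [inv_mul_cancel] at h1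
    have h2 := dist_triangle (φ u⁻¹ (φ u x)) (φ 1 x) x
    linarith [h.one x]
  exact ⟨hlip u, hlip u⁻¹, hinv u, fun x => by simpa using hinv u⁻¹ x⟩

variable {K : Type*} [Group K] {L : ℝ} {q : K → ℝ → ℝ}

lemma abs_mul_le (h : IsQuasiAction L q) (u v : K) (t : ℝ) :
    |q u (q v t) - q (u * v) t| ≤ L := by
  rw [← Real.dist_eq]
  exact h.mul u v t

lemma abs_lip (h : IsQuasiAction L q) (u : K) (s t : ℝ) :
    |q u s - q u t| ≤ L * |s - t| + L := by
  rw [← Real.dist_eq, ← Real.dist_eq]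
  exact h.lip u s t

lemma abs_lower (h : IsQuasiAction L q) (u : K) (s t : ℝ) :
    |s - t| ≤ 2 * L * |q u s - q u t| + 6 * L := by
  have := (h.coarseInverses u).dist_le s t
  rw [Real.dist_eq, Real.dist_eq] at this
  linarith

/-! ### Coarse orientation of a quasi-action on the line. -/

/-- The element `u` coarsely preserves (`σ = 1`) or reverses (`σ = -1`) the orientation. -/
def HasSign (L : ℝ) (q : K → ℝ → ℝ) (σ : ℝ) (u : K) : Prop :=
  (σ = 1 ∨ σ = -1) ∧ ∀ s t, s + 20 * L ^ 2 ≤ t → (t - s) / (2 * L) - 3 ≤ σ * (q u t - q u s)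

lemma exists_hasSign (h : IsQuasiAction L q) (u : K) : ∃ σ, HasSign L q σ u := by
  have hL := h.one_le
  have hL0 : 0 < L := by linarith
  have hd := coarsely_increasing_or_decreasing (q u) (2 * L) (20 * L ^ 2)
    (fun s t hst => (h.abs_lip u s t).trans (by nlinarith))
    (fun s t hst => by
      have := h.abs_lower u s t
      by_contra! hc
      nlinarith) (by positivity)
  have key : ∀ s t, s + 20 * L ^ 2 ≤ t → (t - s) / (2 * L) - 3 ≤ |q u t - q u s| := by
    intro s t hst
    have h1 := h.abs_lower u t s
    rw [abs_of_nonneg (a := t - s) (by nlinarith)] at h1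
    have h2 : (t - s) / (2 * L) ≤ |q u t - q u s| + 3 := by
      rw [div_le_iff₀ (by positivity)]
      linarith
    linarith
  rcases hd with hd | hd
  · refine ⟨1, Or.inl rfl, fun s t hst => ?_⟩
    rw [one_mul, ← abs_of_pos (sub_pos.2 (hd s t hst))]
    exact key s t hst
  · refine ⟨-1, Or.inr rfl, fun s t hst => ?_⟩
    rw [neg_one_mul, ← abs_of_neg (sub_neg.2 (hd s t hst))]
    exact key s t hst

/-- Across a gap of at least `20 L²` the displacement guaranteed by the sign is strictly positive,
so one pair of points decides the sign. -/
lemma HasSign.eq_of_pos {σ τ : ℝ} {u : K} (h : HasSign L q σ u) (hτ : τ = 1 ∨ τ = -1) {t : ℝ}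
    (hL : 1 ≤ L) (ht : 20 * L ^ 2 ≤ t) (hpos : 0 < τ * (q u t - q u 0)) : σ = τ := by
  have h1 := h.2 0 t (by linarith)
  have h2 : 0 < (t - 0) / (2 * L) - 3 := by
    rw [sub_pos, lt_div_iff₀ (by linarith)]
    nlinarith
  rcases h.1 with rfl | rfl <;> rcases hτ with rfl | rfl <;> first | rfl | linarith

lemma HasSign.mul (h : IsQuasiAction L q) {σ τ : ℝ} {u v : K} (hu : HasSign L q σ u)
    (hv : HasSign L q τ v) : HasSign L q (σ * τ) (u * v) := by
  have hL := h.one_le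
  have hL0 : 0 < L := by linarith
  obtain ⟨ρ, hρ⟩ := h.exists_hasSign (u * v)
  -- Large enough that `v` separates `0` and `t` beyond the threshold for `u`, and that the result
  -- beats the two errors `L` between `q u ∘ q v` and `q (u * v)`.
  set t := 2 * L * (20 * L ^ 2 + 2 * L * (2 * L + 4) + 3) with ht
  have ht1 : 20 * L ^ 2 ≤ t := by
    rw [ht]
    nlinarith [mul_nonneg hL0.le (sq_nonneg L), sq_nonneg L]
  have h1 := hv.2 0 t (by linarith)
  have h2 : (t - 0) / (2 * L) - 3 = 20 * L ^ 2 + 2 * L * (2 * L + 4) := by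
    rw [ht]
    field_simp
    ring
  rw [h2] at h1
  have hpos : 0 ≤ 2 * L * (2 * L + 4) := by positivity
  have key : 2 * L + 1 ≤ σ * τ * (q u (q v t) - q u (q v 0)) := by
    rcases hv.1 with hτ | hτ
    · rw [hτ, one_mul] at h1
      have h3 := hu.2 (q v 0) (q v t) (by linarith)
      have h4 : 2 * L + 4 ≤ (q v t - q v 0) / (2 * L) := by
        rw [le_div_iff₀ (by positivity)]
        nlinarith
      rw [hτ, mul_one]
      linarith
    · rw [hτ] at h1
      have h3 := hu.2 (q v t) (q v 0) (by linarith)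
      have h4 : 2 * L + 4 ≤ (q v 0 - q v t) / (2 * L) := by
        rw [le_div_iff₀ (by positivity)]
        nlinarith
      rw [hτ]
      linarith
  have h5 := abs_le.1 (h.abs_mul_le u v t)
  have h6 := abs_le.1 (h.abs_mul_le u v 0)
  have hστ : σ * τ = 1 ∨ σ * τ = -1 := by
    rcases hu.1 with rfl | rfl <;> rcases hv.1 with rfl | rfl <;> norm_num
  have h7 : 0 < σ * τ * (q (u * v) t - q (u * v) 0) := by
    rcases hστ with e | e <;> rw [e] at key ⊢ <;> linarith
  rw [← hρ.eq_of_pos hστ hL ht1 h7]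
  exact hρ

lemma hasSign_one (h : IsQuasiAction L q) : HasSign L q 1 (1 : K) := by
  have hL := h.one_le
  obtain ⟨σ, hσ⟩ := h.exists_hasSign 1
  have h1 := h.one (20 * L ^ 2)
  have h2 := h.one 0
  rw [Real.dist_eq, abs_le] at h1 h2
  have := hσ.eq_of_pos (Or.inl rfl) hL le_rfl (by nlinarith)
  rwa [this] at hσ

lemma HasSign.unique (h : IsQuasiAction L q) {σ τ : ℝ} {u : K} (hσ : HasSign L q σ u)
    (hτ : HasSign L q τ u) : σ = τ := by
  have hL := h.one_le
  refine hσ.eq_of_pos hτ.1 hL le_rfl (lt_of_lt_of_le ?_ (hτ.2 0 (20 * L ^ 2) (by simp)))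
  rw [sub_pos, lt_div_iff₀ (by linarith)]
  nlinarith

lemma HasSign.inv (h : IsQuasiAction L q) {σ : ℝ} {u : K} (hσ : HasSign L q σ u) :
    HasSign L q σ u⁻¹ := by
  obtain ⟨τ, hτ⟩ := h.exists_hasSign u⁻¹
  have h1 := hσ.mul h hτ
  rw [mul_inv_cancel] at h1
  have h2 := h1.unique h h.hasSign_one
  have h3 : τ = σ := by
    rcases hσ.1 with rfl | rfl <;> rcases hτ.1 with rfl | rfl <;> first | rfl | norm_num at h2
  rwa [h3] at hτ

/-- The subgroup of orientation preserving elements. -/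
def positiveSubgroup (h : IsQuasiAction L q) : Subgroup K where
  carrier := {u | HasSign L q 1 u}
  mul_mem' ha hb := by simpa using HasSign.mul h ha hb
  one_mem' := h.hasSign_one
  inv_mem' ha := HasSign.inv h ha

lemma mul_self_mem_positiveSubgroup (h : IsQuasiAction L q) (u : K) :
    u * u ∈ h.positiveSubgroup := by
  obtain ⟨σ, hσ⟩ := h.exists_hasSign u
  have h1 := hσ.mul h hσ
  have h2 : σ * σ = 1 := by rcases hσ.1 with rfl | rfl <;> norm_num
  rwa [h2] at h1

/-! ### Marching powers and proper quasi-actions. -/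

lemma sub_le_of_step {b : ℤ → ℝ} (h : ∀ n, 1 ≤ b (n + 1) - b n) {m n : ℤ} (hmn : m ≤ n) :
    ((n - m : ℤ) : ℝ) ≤ b n - b m := by
  induction n, hmn using Int.leInduction with
  | base => simp
  | succ n hmn ih =>
    have := h n
    push_cast at ih ⊢
    linarith

/-- A sequence with steps between `1` and `C` is coarsely dense. -/
lemma exists_near_of_step {b : ℤ → ℝ} {C : ℝ} (h : ∀ n, 1 ≤ b (n + 1) - b n)
    (h' : ∀ n, b (n + 1) - b n ≤ C) (y : ℝ) : ∃ n, |b n - y| ≤ C := by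
  obtain ⟨n, hn, hmax⟩ := Int.exists_greatest_of_bdd (P := fun n => b n ≤ y)
    ⟨max 0 ⌈y - b 0⌉, fun n hn => by
      rcases le_total n 0 with h0 | h0
      · exact h0.trans (le_max_left _ _)
      · refine le_trans ?_ (le_max_right _ _)
        have := sub_le_of_step h h0
        rw [sub_zero] at this
        have h2 : (n : ℝ) ≤ ⌈y - b 0⌉ := (this.trans (by linarith)).trans (Int.le_ceil _)
        exact_mod_cast h2⟩
    ⟨min 0 ⌊y - b 0⌋, by
      have := sub_le_of_step h (min_le_left 0 ⌊y - b 0⌋)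
      have h2 : ((min 0 ⌊y - b 0⌋ : ℤ) : ℝ) ≤ ⌊y - b 0⌋ := by exact_mod_cast min_le_right _ _
      have h3 := Int.floor_le (y - b 0)
      push_cast at this h2
      linarith⟩
  refine ⟨n, ?_⟩
  have h1 : y < b (n + 1) := by
    by_contra! hc
    have := hmax (n + 1) hc
    omega
  have h2 := h' n
  rw [abs_le]
  constructor <;> linarith

/-- Powers of an orientation preserving element with large displacement march off along the
line. -/
lemma exists_march (h : IsQuasiAction L q) {u : K} (hu : u ∈ h.positiveSubgroup)
    (hbig : 20 * L ^ 2 + 2 * L * (L + 4) ≤ |q u 0|) :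
    ∃ C, 0 ≤ C ∧ (∀ n : ℤ, |(n : ℝ)| ≤ |q (u ^ n) 0| + C) ∧ ∀ y, ∃ n : ℤ, |q (u ^ n) 0 - y| ≤ C := by
  have hL := h.one_le
  have hL0 : 0 < L := by linarith
  have hpos : 0 ≤ 2 * L * (L + 4) := by positivity
  have hsgn : ∀ n : ℤ, HasSign L q 1 (u ^ n) := fun n => h.positiveSubgroup.zpow_mem hu n
  -- All powers `u ^ n` preserve orientation, so each moves `0` and `q u 0` apart in the same
  -- direction, by at least `L + 1`. As `q (u ^ n) (q u 0)` is within `L` of `q (u ^ (n + 1)) 0`,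
  -- the orbit advances by at least `1` per step.
  obtain ⟨τ, hτ, hstep⟩ : ∃ τ : ℝ, |τ| = 1 ∧
      ∀ n : ℤ, L + 1 ≤ τ * (q (u ^ n) (q u 0) - q (u ^ n) 0) := by
    rcases le_total 0 (q u 0) with h0 | h0
    · rw [abs_of_nonneg h0] at hbig
      refine ⟨1, abs_one, fun n => ?_⟩
      have h1 := (hsgn n).2 0 (q u 0) (by linarith)
      have h2 : L + 4 ≤ (q u 0 - 0) / (2 * L) := by
        rw [le_div_iff₀ (by positivity)]
        nlinarith
      linarith
    · rw [abs_of_nonpos h0] at hbig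
      refine ⟨-1, by simp, fun n => ?_⟩
      have h1 := (hsgn n).2 (q u 0) 0 (by linarith)
      have h2 : L + 4 ≤ (0 - q u 0) / (2 * L) := by
        rw [le_div_iff₀ (by positivity)]
        nlinarith
      linarith
  have hτ2 : τ * τ = 1 := by rw [← abs_mul_abs_self, hτ, one_mul]
  set b : ℤ → ℝ := fun n => τ * q (u ^ n) 0 with hb
  have hnear : ∀ n : ℤ, |τ * (q (u ^ n) (q u 0) - q (u ^ (n + 1)) 0)| ≤ L := by
    intro n
    rw [abs_mul, hτ, one_mul, zpow_add_one]
    exact h.abs_mul_le _ _ _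
  have hlow : ∀ n, 1 ≤ b (n + 1) - b n := by
    intro n
    have h1 := (abs_le.1 (hnear n)).2
    have h2 := hstep n
    simp only [hb]
    linarith
  set C := L * |q u 0| + 2 * L with hC
  have hupp : ∀ n, b (n + 1) - b n ≤ C := by
    intro n
    have h1 := (abs_le.1 (hnear n)).1
    have h2 := h.abs_lip (u ^ n) (q u 0) 0
    have h3 : |τ * (q (u ^ n) (q u 0) - q (u ^ n) 0)| ≤ L * |q u 0| + L := by
      rw [abs_mul, hτ, one_mul]
      rwa [sub_zero] at h2
    have h4 := (abs_le.1 h3).2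
    simp only [hb]
    linarith
  have habs : ∀ x, |τ * x| = |x| := fun x => by rw [abs_mul, hτ, one_mul]
  have hC0 : 0 ≤ C := by positivity
  refine ⟨C + |b 0|, by positivity, fun n => ?_, fun y => ?_⟩
  · rw [← habs (q (u ^ n) 0)]
    change |(n : ℝ)| ≤ |b n| + (C + |b 0|)
    have h1 := abs_sub (b n) (b 0)
    rcases le_total 0 n with h0 | h0
    · have h2 := sub_le_of_step hlow h0
      have h3 := le_abs_self (b n - b 0)
      rw [abs_of_nonneg (by exact_mod_cast h0)]
      push_cast at h2
      linarith
    · have h2 := sub_le_of_step hlow h0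
      have h3 := neg_le_abs (b n - b 0)
      rw [abs_of_nonpos (by exact_mod_cast h0)]
      push_cast at h2
      linarith
  · obtain ⟨n, hn⟩ := exists_near_of_step hlow hupp (τ * y)
    refine ⟨n, ?_⟩
    simp only [hb] at hn
    rw [← mul_sub, habs] at hn
    linarith [abs_nonneg (b 0)]

/-- A quasi-action on the line in which only finitely many elements move the origin by a bounded
amount. -/
def IsProper (q : K → ℝ → ℝ) : Prop := ∀ r : ℝ, {u | |q u 0| ≤ r}.Finite

/-- Choose `u ^ n` moving `0` close to where `k` moves it; then `(u ^ n)⁻¹ * k` has bounded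
displacement, so properness leaves finitely many choices. -/
lemma exists_finite_zpow_mul (h : IsQuasiAction L q) (hfin : IsProper q) {u : K} {C : ℝ}
    (hdense : ∀ y, ∃ n : ℤ, |q (u ^ n) 0 - y| ≤ C) :
    ∃ E : Set K, E.Finite ∧ ∀ k, ∃ n : ℤ, ∃ e ∈ E, u ^ n * e = k := by
  have hL := h.one_le
  refine ⟨_, hfin (L * C + 4 * L), fun k => ?_⟩
  obtain ⟨n, hn⟩ := hdense (q k 0)
  refine ⟨n, (u ^ n)⁻¹ * k, ?_, mul_inv_cancel_left _ _⟩
  have h1 := abs_le.1 (h.abs_mul_le (u ^ n)⁻¹ k 0)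
  have h2 := abs_le.1 (h.abs_lip (u ^ n)⁻¹ (q (u ^ n) 0) (q k 0))
  have h3 := abs_le.1 (h.abs_mul_le (u ^ n)⁻¹ (u ^ n) 0)
  have h4 := h.one 0
  rw [inv_mul_cancel] at h3
  rw [Real.dist_eq, abs_le] at h4
  have h5 := mul_le_mul_of_nonneg_left hn (by linarith : 0 ≤ L)
  change |q ((u ^ n)⁻¹ * k) 0| ≤ _
  rw [abs_le]
  constructor <;> linarith

lemma finiteIndex_zpowers_of_finite {u : K} {E : Set K} (hE : E.Finite)
    (hcov : ∀ k, ∃ n : ℤ, ∃ e ∈ E, u ^ n * e = k) : (Subgroup.zpowers u).FiniteIndex := by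
  have : Finite E := hE
  have hsurj : Function.Surjective
      fun e : E => (QuotientGroup.mk (e : K)⁻¹ : K ⧸ Subgroup.zpowers u) := by
    intro x
    induction x using QuotientGroup.induction_on with
    | H k =>
      -- The quotient consists of left cosets while the cover is by `⟨u⟩ e`; inverting exchanges the
      -- two.
      obtain ⟨n, e, he, hk⟩ := hcov k⁻¹
      refine ⟨⟨e, he⟩, ?_⟩
      rw [QuotientGroup.eq]
      refine ⟨-n, ?_⟩
      have hk' : k = e⁻¹ * (u ^ n)⁻¹ := by rw [← mul_inv_rev, hk, inv_inv]
      rw [hk']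
      simp
  have := Finite.of_surjective _ hsurj
  exact Subgroup.finiteIndex_of_finite_quotient

/-- A group with an infinite proper quasi-action on the line has an orientation preserving element
with large displacement. -/
lemma exists_large_displacement [Infinite K] (h : IsQuasiAction L q) (hfin : IsProper q) (M : ℝ) :
    ∃ u ∈ h.positiveSubgroup, M ≤ |q u 0| := by
  by_contra! hno
  have hF : {u | HasSign L q 1 u}.Finite :=
    (hfin M).subset fun u hu => (hno u hu).le
  -- The orientation reversing elements, if any, form a single coset of the orientation preserving
  -- ones.
  have hneg : {u | HasSign L q (-1) u}.Finite := by
    rcases Set.eq_empty_or_nonempty {u | HasSign L q (-1) u} with he | ⟨v, hv⟩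
    · rw [he]; exact Set.finite_empty
    · refine (hF.image fun w => v * w).subset fun w hw => ⟨v⁻¹ * w, ?_, mul_inv_cancel_left _ _⟩
      simpa using (HasSign.inv h hv).mul h hw
  refine Set.infinite_univ (α := K) ((hF.union hneg).subset fun u _ => ?_)
  obtain ⟨σ, hσ⟩ := h.exists_hasSign u
  rcases hσ.1 with rfl | rfl
  · exact Or.inl hσ
  · exact Or.inr hσ

lemma not_isOfFinOrder_of_march {u : K} {C : ℝ}
    (hgrow : ∀ n : ℤ, |(n : ℝ)| ≤ |q (u ^ n) 0| + C) : ¬ IsOfFinOrder u := by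
  intro hu
  obtain ⟨m, hm, hum⟩ := isOfFinOrder_iff_pow_eq_one.1 hu
  obtain ⟨k, hk⟩ := exists_nat_gt (|q 1 0| + C)
  have h1 := hgrow ((m * k : ℕ) : ℤ)
  rw [zpow_natCast, pow_mul, hum, one_pow] at h1
  have h2 : (k : ℝ) ≤ (m * k : ℕ) := by
    have : k ≤ m * k := Nat.le_mul_of_pos_left k hm
    exact_mod_cast this
  rw [Int.cast_natCast, Nat.abs_cast] at h1
  linarith

theorem exists_not_isOfFinOrder [Infinite K] (h : IsQuasiAction L q) (hfin : IsProper q) :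
    ∃ u : K, ¬ IsOfFinOrder u := by
  obtain ⟨u, hu, hbig⟩ := h.exists_large_displacement hfin _
  obtain ⟨C, _, hgrow, _⟩ := h.exists_march hu hbig
  exact ⟨u, not_isOfFinOrder_of_march hgrow⟩

/-- The square of `u` preserves orientation, and its infinitely many powers cannot all have small
displacement by properness, so one of them marches. -/
theorem finiteIndex_zpowers (h : IsQuasiAction L q) (hfin : IsProper q) {u : K}
    (hu : ¬ IsOfFinOrder u) : (Subgroup.zpowers u).FiniteIndex := by
  have hinj : Function.Injective fun n : ℕ => (u * u) ^ n := by
    have h1 := injective_pow_iff_not_isOfFinOrder.2 hu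
    intro a b hab
    dsimp only at hab
    rw [← pow_two, ← pow_mul, ← pow_mul] at hab
    have := h1 hab
    omega
  obtain ⟨n, hn⟩ : ∃ n : ℕ, 20 * L ^ 2 + 2 * L * (L + 4) < |q ((u * u) ^ n) 0| := by
    by_contra! hno
    exact Set.infinite_range_of_injective hinj
      ((hfin _).subset (by rintro _ ⟨n, rfl⟩; exact hno n))
  obtain ⟨C, _, _, hdense⟩ := h.exists_march
    (h.positiveSubgroup.pow_mem (h.mul_self_mem_positiveSubgroup u) n) hn.le
  obtain ⟨E, hE, hcov⟩ := h.exists_finite_zpow_mul hfin hdense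
  have := finiteIndex_zpowers_of_finite hE hcov
  refine Subgroup.finiteIndex_of_le (H := Subgroup.zpowers ((u * u) ^ n)) ?_
  rw [Subgroup.zpowers_le, ← pow_two, ← pow_mul]
  exact Subgroup.npow_mem_zpowers u _

/-- A group with a proper quasi-action on the line is finite or quasi-isometric to the line. -/
theorem finite_or_groupQuasiIsometricToReal (h : IsQuasiAction L q) (hfin : IsProper q) :
    Finite K ∨ GroupQuasiIsometricToReal K := by
  rcases finite_or_infinite K with hK | hK
  · exact Or.inl hK
  right
  have hL := h.one_le
  have hL0 : 0 < L := by linarith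
  obtain ⟨u, hu, hbig⟩ := h.exists_large_displacement hfin _
  obtain ⟨C, hC0, hgrow, hdense⟩ := h.exists_march hu hbig
  obtain ⟨E, hE, hcov⟩ := h.exists_finite_zpow_mul hfin hdense
  have hdense' : ∀ y, ∃ k, |y - q k 0| ≤ C := fun y => by
    obtain ⟨n, hn⟩ := hdense y
    exact ⟨u ^ n, by rwa [abs_sub_comm]⟩
  refine ⟨?_, fun T hT => ?_⟩
  · rw [Group.fg_iff]
    refine ⟨insert u E, ?_, hE.insert u⟩
    rw [Subgroup.eq_top_iff']
    intro k
    obtain ⟨n, e, he, rfl⟩ := hcov k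
    exact mul_mem (Subgroup.zpow_mem _ (Subgroup.subset_closure (Set.mem_insert u E)) n)
      (Subgroup.subset_closure (Set.mem_insert_of_mem u he))
  obtain ⟨Q, hQ⟩ : ∃ Q, ∀ a ∈ T, |q a 0| ≤ Q := by
    obtain ⟨Q, hQ⟩ := (T.finite_toSet.image fun a => |q a 0|).bddAbove
    exact ⟨Q, fun a ha => hQ ⟨a, ha, rfl⟩⟩
  obtain ⟨W, hW⟩ : ∃ W, ∀ e ∈ E, wordDist T 1 e ≤ W := by
    obtain ⟨W, hW⟩ := (hE.image fun e => wordDist T 1 e).bddAbove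
    exact ⟨W, fun a ha => hW ⟨a, ha, rfl⟩⟩
  obtain ⟨P, hP⟩ : ∃ P, ∀ e ∈ E, |q e 0| ≤ P := by
    obtain ⟨P, hP⟩ := (hE.image fun e => |q e 0|).bddAbove
    exact ⟨P, fun a ha => hP ⟨a, ha, rfl⟩⟩
  set w := wordDist T 1 u with hw
  have hw0 : 0 ≤ w := wordDist_nonneg _ _
  -- word length is controlled by the displacement of the origin
  have hlen : ∀ k, wordDist T 1 k ≤ (|q k 0| + (L * |P| + 2 * L + C)) * w + |W| := by
    intro k
    obtain ⟨n, e, he, rfl⟩ := hcov k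
    have h1 := hT.wordDist_one_mul_le (u ^ n) e
    have h2 := hT.wordDist_one_zpow_le u n
    have h3 := (hW e he).trans (le_abs_self W)
    have h4 := h.abs_mul_le (u ^ n) e 0
    have h5 := h.abs_lip (u ^ n) (q e 0) 0
    rw [sub_zero] at h5
    have h6 := mul_le_mul_of_nonneg_left ((hP e he).trans (le_abs_self P)) hL0.le
    have h7 : |q (u ^ n) 0| ≤ |q (u ^ n * e) 0| + (L * |P| + 2 * L) := by
      have a1 := abs_sub_abs_le_abs_sub (q (u ^ n) 0) (q (u ^ n * e) 0)
      have a2 := abs_sub_le (q (u ^ n) 0) (q (u ^ n) (q e 0)) (q (u ^ n * e) 0)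
      rw [abs_sub_comm (q (u ^ n) 0) (q (u ^ n) (q e 0))] at a2
      linarith
    have h8 := hgrow n
    have h9 : |(n : ℝ)| * w ≤ (|q (u ^ n * e) 0| + (L * |P| + 2 * L + C)) * w :=
      mul_le_mul_of_nonneg_right (by linarith) hw0
    linarith
  -- Applying `k` carries the images of `0` under `k⁻¹ * k'` and under `1` close to those under `k'`
  -- and `k`, matching the left invariance of the word metric.
  have hdisp : ∀ k k', |q (k⁻¹ * k') 0| ≤ 2 * L * |q k 0 - q k' 0| + 12 * L ^ 2 := by
    intro k k'
    have h1 := h.abs_lower k (q (k⁻¹ * k') 0) 0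
    rw [sub_zero] at h1
    have h2 := h.abs_mul_le k (k⁻¹ * k') 0
    rw [mul_inv_cancel_left] at h2
    have h3 := abs_sub_le (q k (q (k⁻¹ * k') 0)) (q k' 0) (q k 0)
    rw [abs_sub_comm (q k' 0)] at h3
    have h4 := mul_le_mul_of_nonneg_left (h3.trans (add_le_add_left h2 _))
      (by positivity : 0 ≤ 2 * L)
    nlinarith
  set A := 1 + C + (L * |Q| + 2 * L) + 2 * L * w
    + ((12 * L ^ 2 + (L * |P| + 2 * L + C)) * w + |W|) with hA
  have p1 : 0 ≤ L * |Q| + 2 * L := by positivity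
  have p2 : 0 ≤ 2 * L * w := by positivity
  have p3 : 0 ≤ (12 * L ^ 2 + (L * |P| + 2 * L + C)) * w + |W| := by positivity
  refine quasiIsometric_real_of_coarse _ (fun k => q k 0) A (by linarith) ?_ ?_ ?_
  · intro k k'
    have h1 := hT.abs_sub_le_mul_wordDist (f := fun k => q k 0) (C := L * |Q| + 2 * L) (fun k a ha => by
      have a1 := h.abs_mul_le k a 0
      have a2 := h.abs_lip k (q a 0) 0
      rw [sub_zero] at a2
      have a3 := mul_le_mul_of_nonneg_left ((hQ a ha).trans (le_abs_self Q)) hL0.le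
      have a4 := abs_sub_le (q (k * a) 0) (q k (q a 0)) (q k 0)
      rw [abs_sub_comm (q (k * a) 0) (q k (q a 0))] at a4
      linarith) k k'
    rw [abs_sub_comm] at h1
    refine h1.trans (mul_le_mul_of_nonneg_right (by linarith) (wordDist_nonneg _ _))
  · intro k k'
    have h1 := hlen (k⁻¹ * k')
    have h2 := wordDist_mul_left (S := T) k⁻¹ k k'
    rw [inv_mul_cancel] at h2
    rw [h2] at h1
    have h3 := mul_le_mul_of_nonneg_right (hdisp k k') hw0
    have h4 : 2 * L * w * |q k 0 - q k' 0| ≤ A * |q k 0 - q k' 0| :=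
      mul_le_mul_of_nonneg_right (by linarith) (abs_nonneg _)
    linarith
  · intro y
    obtain ⟨k, hk⟩ := hdense' y
    exact ⟨k, by linarith⟩

end IsQuasiAction

/-! ### The boundary action of a quasi-action -/

/-- A quasi-action on the hyperbolic plane induces an action on the boundary circle. -/
theorem IsQuasiAction.existsUnique_boundary_hom {G : Type*} [Group G] {L : ℝ} {f : G → ℍ → ℍ}
    (h : IsQuasiAction L f) :
    ∃! Ξ : G →* Equiv.Perm (OnePoint ℝ), ∀ u, IsBoundaryMap (f u) (Ξ u) := by
  have hL := h.one_le
  have hL6 : 1 ≤ 3 * (2 * L) := by linarith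
  have hemb : ∀ u, CoarseEmb (3 * (2 * L)) (f u) := fun u =>
    (h.coarseInverses u).coarseEmb (by linarith)
  choose F hF using fun u => exists_isBoundaryMap hL6 (hemb u)
  -- The boundary maps form a monoid homomorphism by uniqueness of boundary values; since the source
  -- is a group, its values are permutations.
  let F' : G →* Function.End (OnePoint ℝ) :=
    { toFun := F
      map_one' := (hF 1).unique hL6 (hemb 1) (isBoundaryMap_id.congr h.one)
      map_mul' := fun u v => (hF (u * v)).unique hL6 (hemb _)
        (((hF u).comp hL (h.lip u) (hF v)).congr fun z => by
          rw [dist_comm]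
          exact h.mul u v z) }
  refine ⟨F'.toHomPerm, hF, fun Ξ hΞ => ?_⟩
  ext u ξ
  exact congrFun ((hΞ u).unique hL6 (hemb u) (hF u)) ξ

/-! ### Splitting a quasi-action on `ℍ × ℝ` into horizontal and vertical parts. -/

section HorizontalMap

variable {Γ : Type*} [Group Γ] {φ : Γ → HypPlaneTimesReal → HypPlaneTimesReal} {L : ℝ}

/-- A quasi-action on `ℍ × ℝ` is close to one that permutes the vertical lines. -/
lemma IsQuasiAction.exists_dist_fst_le (h : IsQuasiAction L φ) :
    ∃ D : ℝ, 0 ≤ D ∧ ∀ u z t t', dist (φ u (hypPt z t)).fst (φ u (hypPt z t')).fst ≤ D := by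
  obtain ⟨D, hD⟩ := _root_.exists_dist_fst_le (L := 2 * L) (by linarith [h.one_le])
  exact ⟨|D|, abs_nonneg D, fun u z t t' =>
    (hD _ _ (h.coarseInverses u) z t t').trans (le_abs_self D)⟩

/-- A quasi-action on `ℍ × ℝ` induces one on `ℍ`. -/
lemma IsQuasiAction.horizontal (h : IsQuasiAction L φ) :
    ∃ L', IsQuasiAction L' fun u z => (φ u (hypPt z 0)).fst := by
  obtain ⟨D, hD0, hD⟩ := h.exists_dist_fst_le
  have hL := h.one_le
  refine ⟨L + D, by linarith, fun u z w => ?_, fun u v z => ?_, fun z => ?_⟩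
  · have h1 := (dist_fst_le _ _).trans (h.lip u (hypPt z 0) (hypPt w 0))
    have h2 := dist_le_fst_add_snd (hypPt z 0) (hypPt w 0)
    rw [hypPt_fst, hypPt_fst, hypPt_snd, hypPt_snd, sub_self, abs_zero, add_zero] at h2
    have h3 : 0 ≤ dist z w := dist_nonneg
    have h4 := mul_le_mul_of_nonneg_left h2 (by linarith : 0 ≤ L)
    nlinarith
  · have h1 := hD u (φ v (hypPt z 0)).fst 0 (φ v (hypPt z 0)).snd
    rw [hypPt_fst_snd] at h1
    have h2 := (dist_fst_le _ _).trans (h.mul u v (hypPt z 0))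
    exact (dist_triangle _ _ _).trans (by linarith)
  · have h1 := (dist_fst_le _ _).trans (h.one (hypPt z 0))
    rw [hypPt_fst] at h1
    linarith

/-- The elements of a subgroup which act with bounded horizontal displacement quasi-act on the
vertical line through `i`. -/
lemma IsQuasiAction.vertical (h : IsQuasiAction L φ) {K : Subgroup Γ} {D : ℝ}
    (hD : ∀ u ∈ K, ∀ x, dist (φ u x).fst x.fst ≤ D) :
    ∃ L', IsQuasiAction L' fun (u : K) t => (φ u (hypPt UpperHalfPlane.I t)).snd := by
  have hL := h.one_le
  have hD0 : 0 ≤ D := dist_nonneg.trans (hD 1 K.one_mem (hypPt UpperHalfPlane.I 0))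
  have hLD : 0 ≤ L * D := by positivity
  refine ⟨2 * L + L * D, by linarith, fun u s t => ?_, fun u v t => ?_, fun t => ?_⟩
  · have h1 := (abs_snd_sub_le _ _).trans
      (h.lip u (hypPt UpperHalfPlane.I s) (hypPt UpperHalfPlane.I t))
    rw [dist_hypPt_same_fst] at h1
    rw [Real.dist_eq, Real.dist_eq]
    have h2 := abs_nonneg (s - t)
    nlinarith
  · set y := φ v (hypPt UpperHalfPlane.I t) with hy
    have h1 : dist (hypPt UpperHalfPlane.I y.snd) y ≤ D := by
      have h2 := dist_le_fst_add_snd (hypPt UpperHalfPlane.I y.snd) y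
      rw [hypPt_fst, hypPt_snd, sub_self, abs_zero, add_zero, dist_comm UpperHalfPlane.I] at h2
      exact h2.trans (hD v v.2 (hypPt UpperHalfPlane.I t))
    have h2 := h.lip u (hypPt UpperHalfPlane.I y.snd) y
    have h3 := h.mul u v (hypPt UpperHalfPlane.I t)
    rw [← hy] at h3
    have h4 := dist_triangle (φ u (hypPt UpperHalfPlane.I y.snd)) (φ u y)
      (φ (u * v) (hypPt UpperHalfPlane.I t))
    have h5 := mul_le_mul_of_nonneg_left h1 (by linarith : 0 ≤ L)
    rw [Real.dist_eq]
    refine (abs_snd_sub_le _ _).trans ?_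
    rw [Subgroup.coe_mul]
    linarith
  · have h1 := (abs_snd_sub_le _ _).trans (h.one (hypPt UpperHalfPlane.I t))
    rw [hypPt_snd] at h1
    rw [Real.dist_eq]
    refine le_trans ?_ (h1.trans (by linarith))
    rfl

end HorizontalMap

/-! ### The quasi-action of `Γ`, properness on the kernel, and the theorem. -/

section Main

variable {Γ : Type*} [Group Γ] {S : Finset Γ} {lam ε δ : ℝ} {ψ : Γ → HypPlaneTimesReal}
  {ω : HypPlaneTimesReal → Γ}

lemma IsQuasiIsometryPair.isQuasiAction (hS : IsSymmGeneratingSet S)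
    (h : IsQuasiIsometryPair (wordDist S) (fun x y : HypPlaneTimesReal => dist x y) lam ε δ ψ ω) :
    ∃ L, IsQuasiAction L (quasiAction ψ ω) := by
  obtain ⟨κ, hκ, hκ'⟩ := h.almost_inverse
  have hlam := h.left.one_le
  have hε := h.left.eps_nonneg
  have hκ0 : 0 ≤ κ := (wordDist_nonneg _ _).trans (hκ 1)
  have h0 : 0 ≤ lam * ε := by positivity
  have h0' : 0 ≤ lam * κ := by positivity
  have h0'' := sq_nonneg lam
  refine ⟨lam ^ 2 + lam * ε + ε + lam * κ + κ + 1, by linarith, fun u x y => ?_,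
    fun u v x => ?_, fun x => ?_⟩
  · have h1 := h.left.upper (u * ω x) (u * ω y)
    rw [wordDist_mul_left] at h1
    have h2 := mul_le_mul_of_nonneg_left (h.right.upper x y) (by linarith : 0 ≤ lam)
    have h3 : 0 ≤ dist x y := dist_nonneg
    simp only [quasiAction]
    have h4 : 0 ≤ (lam * ε + ε + lam * κ + κ + 1) * dist x y := by positivity
    nlinarith
  · have h1 := h.left.upper (u * ω (ψ (v * ω x))) (u * (v * ω x))
    rw [wordDist_mul_left, hS.wordDist_comm] at h1
    have h2 := mul_le_mul_of_nonneg_left (hκ (v * ω x)) (by linarith : 0 ≤ lam)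
    simp only [quasiAction]
    rw [mul_assoc]
    linarith
  · have h1 := hκ' x
    rw [dist_comm] at h1
    simp only [quasiAction, one_mul]
    linarith

/-- With horizontal displacement already bounded, a small vertical displacement keeps `ψ (u * ω o)`
near `o`, so `u * ω o` lies in a fixed finite ball of the word metric and determines `u`. -/
lemma IsQuasiIsometryPair.isProper_vertical (hS : IsSymmGeneratingSet S)
    (h : IsQuasiIsometryPair (wordDist S) (fun x y : HypPlaneTimesReal => dist x y) lam ε δ ψ ω)
    {K : Subgroup Γ} {D : ℝ} (hD : ∀ u ∈ K, ∀ x, dist (quasiAction ψ ω u x).fst x.fst ≤ D) :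
    IsQuasiAction.IsProper
      fun (u : K) t => (quasiAction ψ ω u (hypPt UpperHalfPlane.I t)).snd := by
  obtain ⟨κ, -, hκ⟩ := h.almost_inverse
  have hlam := h.left.one_le
  intro r
  set o := hypPt UpperHalfPlane.I 0 with ho
  have hfin := hS.finite_ball (ω o) (lam * (D + r + κ + ε))
  have hinj : Function.Injective fun u : K => (u : Γ) * ω o := fun u v huv =>
    Subtype.ext (mul_right_cancel huv)
  refine (hfin.preimage hinj.injOn).subset fun u hu => ?_
  change |(quasiAction ψ ω u o).snd| ≤ r at hu
  change wordDist S (ω o) (u * ω o) ≤ _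
  have h1 := h.left.lower (ω o) (u * ω o)
  have h2 := dist_le_fst_add_snd (quasiAction ψ ω u o) o
  have h3 := hD u u.2 o
  rw [ho, hypPt_snd, sub_zero, ← ho] at h2
  have h4 : dist (ψ (ω o)) (ψ (u * ω o)) ≤ κ + (D + r) := by
    refine (dist_triangle_left _ _ o).trans (add_le_add (hκ o) ?_)
    rw [dist_comm]
    exact h2.trans (add_le_add h3 hu)
  have h5 : 1 / lam * wordDist S (ω o) (u * ω o) ≤ D + r + κ + ε := by
    linarith
  rwa [one_div_mul_eq_div, div_le_iff₀' (by linarith)] at h5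

end Main

/-- A homomorphism to the isometries of the plane which is conjugate to the boundary action has
the same kernel. -/
lemma IsConjugateToBoundaryAction.ker_eq {Γ : Type*} [Group Γ]
    {Ξ : Γ →* Equiv.Perm (OnePoint ℝ)} {Φ : Γ →* (ℍ ≃ᵢ ℍ)}
    (h : IsConjugateToBoundaryAction Ξ Φ) : Φ.ker = Ξ.ker := by
  obtain ⟨c, hc⟩ := h
  ext u
  rw [MonoidHom.mem_ker, MonoidHom.mem_ker]
  constructor
  · intro hu
    have h1 := hc u
    rw [hu] at h1
    have h2 := IsBoundaryMap.unique le_rfl (coarseEmb_isometry isometry_id) h1 isBoundaryMap_id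
    rw [← conj_eq_one_iff (a := c)]
    exact Equiv.ext fun ξ => congrFun h2 ξ
  · intro hu
    have h1 := hc u
    rw [hu, mul_one, mul_inv_cancel] at h1
    exact IsometryEquiv.ext fun z => isometry_eq_of_isBoundaryMap_id (Φ u).isometry h1 z

theorem theorem5p7 {Γ : Type*} [Group Γ] (S : Finset Γ) (hS : IsSymmGeneratingSet S)
    (lam ε δ : ℝ) (ψ : Γ → HypPlaneTimesReal) (ω : HypPlaneTimesReal → Γ)
    (hψω : IsQuasiIsometryPair (wordDist S) (fun x y : HypPlaneTimesReal => dist x y)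
      lam ε δ ψ ω) :
    -- the boundary action exists and is unique
    (∃! Ξ : Γ →* Equiv.Perm (OnePoint ℝ), IsBoundaryAction ψ ω Ξ) ∧
    ∀ Ξ : Γ →* Equiv.Perm (OnePoint ℝ), IsBoundaryAction ψ ω Ξ →
      -- its kernel is finite or quasi-isometric to the real line
      (Finite Ξ.ker ∨ GroupQuasiIsometricToReal Ξ.ker) ∧
      -- an infinite kernel has an element of infinite order, and every such element
      -- generates a subgroup of finite index in the kernel
      (Infinite Ξ.ker → ∃ u : Ξ.ker, ¬ IsOfFinOrder u) ∧
      (∀ u : Ξ.ker, ¬ IsOfFinOrder u → (Subgroup.zpowers u).FiniteIndex) ∧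
      -- the homomorphism to isometries of the plane has the same kernel
      (∀ Φ : Γ →* (ℍ ≃ᵢ ℍ), IsConjugateToBoundaryAction Ξ Φ →
        Φ.ker = Ξ.ker ∧ (Finite Φ.ker ∨ GroupQuasiIsometricToReal Φ.ker)) := by
  obtain ⟨L, hφ⟩ := hψω.isQuasiAction hS
  obtain ⟨L', hf⟩ := hφ.horizontal
  refine ⟨hf.existsUnique_boundary_hom, fun Ξ hΞ => ?_⟩
  obtain ⟨D₁, -, hD₁⟩ := hφ.exists_dist_fst_le
  have hL' : 1 ≤ 2 * L' := by linarith [hf.one_le]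
  obtain ⟨D₂, hD₂⟩ := exists_dist_le_of_isBoundaryMap_id (L := 3 * (2 * L')) (by linarith)
  -- The bound for `f_u` concerns height `0`; the vertical line estimate `D₁` extends it to every
  -- height.
  have hdisp : ∀ u ∈ Ξ.ker, ∀ x, dist (quasiAction ψ ω u x).fst x.fst ≤ D₁ + D₂ := by
    intro u hu x
    have h1 : IsBoundaryMap (horizontalMap ψ ω u) id := by
      have := hΞ u
      rwa [MonoidHom.mem_ker.1 hu] at this
    have h2 := hD₂ _ ((hf.coarseInverses u).coarseEmb hL') h1 x.fst
    have h3 := hD₁ u x.fst x.snd 0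
    rw [hypPt_fst_snd] at h3
    exact (dist_triangle _ _ _).trans (add_le_add h3 h2)
  obtain ⟨L'', hq⟩ := hφ.vertical hdisp
  have hfin := hψω.isProper_vertical hS hdisp
  have hker := hq.finite_or_groupQuasiIsometricToReal hfin
  refine ⟨hker, fun _ => hq.exists_not_isOfFinOrder hfin,
    fun u hu => hq.finiteIndex_zpowers hfin hu, fun Φ hΦ => ?_⟩
  have e := hΦ.ker_eq
  rw [e]
  exact ⟨rfl, hker⟩

end
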